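/- Let $n\ge 1$, $1<q<\infty$, $0<\beta_0<\tfrac12$ and $B_1,B_2>0$. There is a constant $C>0$, depending only on $n,q,B_1,B_2$ and $\beta_0$, with the following property. Let $\Omega:\mathbb{R}^n\to\mathbb{R}$ satisfy, for all $x\in\mathbb{R}^n\setminus\{0\}$ and $r>0$, $$|\Omega(x)|\le B_1,\qquad \Omega(rx)=\Omega(x),\qquad \int_{|x|=1}\Omega\,d\sigma=0,\qquad \int_0^1\frac{\omega(\delta)}{\delta}\,d\delta\le B_2,$$ where $\sigma$ is the surface measure on the unit sphere (counting measure on $\{-1,1\}$ if $n=1$) and $\omega(\delta)=\sup\{|\Omega(x)-\Omega(x')|:\ |x-x'|\le\delta,\ |x|=|x'|=1\}$. Then for every real-valued $f\in L^1(\mathbb{R}^n)\cap L^q(\mathbb{R}^n)$, every $\varepsilon>0$ and every $\beta$ with $0<\beta<\min\{1-\beta_0,\tfrac{(q-1)n}{q}\}$, the integral $$T_\varepsilon f(x)=\int_{|y|\ge\varepsilon}\frac{\Omega(y)}{|y|^{n-\beta}}\,f(x-y)\,dy$$ converges absolutely for every $x\in\mathbb{R}^n$, $T_\varepsilon f\in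 L^q(\mathbb{R}^n)$, and $$\|T_\varepsilon f\|_q\le C\left(\|f\|_q+\frac{\beta^{(q-1)n/q}}{\bigl(n(q-1)-\beta q\bigr)^{1/q}}\,\|f\|_1\right).$$ -/

import Mathlib

open MeasureTheory
open scoped ENNReal

/-- The modulus of continuity of `Ω` on the unit sphere of `ℝⁿ`,
`ω(δ) = sup {|Ω(x) - Ω(x')| : |x - x'| ≤ δ, |x| = |x'| = 1}`, as an extended nonnegative real. -/
noncomputable def sphereModulus {n : ℕ} (Ω : EuclideanSpace ℝ (Fin n) → ℝ) (δ : ℝ) : ℝ≥0∞ :=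
  ⨆ (x : EuclideanSpace ℝ (Fin n)) (x' : EuclideanSpace ℝ (Fin n))
    (_ : ‖x‖ = 1) (_ : ‖x'‖ = 1) (_ : ‖x - x'‖ ≤ δ), ENNReal.ofReal |Ω x - Ω x'|

/-- `Ω` is bounded by `B₁` away from the origin, positively homogeneous of degree `0`, has mean
zero on the unit sphere for the surface measure, and its modulus of continuity `ω` there satisfies
the Dini condition `∫₀¹ ω(δ) / δ dδ ≤ B₂`. -/
structure IsDiniKernel {n : ℕ} (Ω : EuclideanSpace ℝ (Fin n) → ℝ) (B₁ B₂ : ℝ) : Prop where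
  bounded : ∀ x, x ≠ 0 → |Ω x| ≤ B₁
  homogeneous : ∀ r : ℝ, 0 < r → ∀ x, x ≠ 0 → Ω (r • x) = Ω x
  cancellation :
    ∫ x : Metric.sphere (0 : EuclideanSpace ℝ (Fin n)) 1, Ω x
      ∂(volume : Measure (EuclideanSpace ℝ (Fin n))).toSphere = 0
  dini : ∫⁻ δ in Set.Ioc (0 : ℝ) 1, sphereModulus Ω δ / ENNReal.ofReal δ ≤ ENNReal.ofReal B₂

/-- The integrand `y ↦ Ω(y) |y|^(β - n) f(x - y)`. -/
noncomputable def truncIntegrand {n : ℕ} (Ω : EuclideanSpace ℝ (Fin n) → ℝ) (β : ℝ)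
    (f : EuclideanSpace ℝ (Fin n) → ℝ) (x y : EuclideanSpace ℝ (Fin n)) : ℝ :=
  Ω y / ‖y‖ ^ ((n : ℝ) - β) * f (x - y)

/-- The truncated operator `T_ε f(x) = ∫_{|y| ≥ ε} Ω(y) |y|^(β - n) f(x - y) dy`. -/
noncomputable def truncOp {n : ℕ} (Ω : EuclideanSpace ℝ (Fin n) → ℝ) (β ε : ℝ)
    (f : EuclideanSpace ℝ (Fin n) → ℝ) (x : EuclideanSpace ℝ (Fin n)) : ℝ :=
  ∫ y in {y | ε ≤ ‖y‖}, truncIntegrand Ω β f x y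

open Set Metric Module Filter Topology
open scoped NNReal FourierTransform

/-! ### Polar coordinates. -/

section Radial

variable {E : Type*} [NormedAddCommGroup E] [InnerProductSpace ℝ E] [FiniteDimensional ℝ E]
  [MeasurableSpace E] [BorelSpace E]

/-! The kernel Ω(y)|y|^(β-n) on |y| ≥ ε is cut at the radius 1/β.

Near part. For r < 1/β one has r^β ≤ β^(-β) ≤ e, so on ε ≤ |y| < 1/β the kernel satisfies the size
and regularity bounds of the critical kernel Ω(y)|y|^(-n), with constants independent of β and ε.
Convolution with it is therefore bounded on L^q by Calderón–Zygmund theory, which produces the term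
C‖f‖_q.

Far part. Put κ = n(q-1) - βq, which is positive because β < (q-1)n/q. On |y| ≥ max(ε, 1/β) the
kernel lies in L^q: polar coordinates bound its norm by a constant times β^(κ/q) κ^(-1/q), and
β^(κ/q) = β^(-β) β^((q-1)n/q) ≤ e β^((q-1)n/q). Young's inequality L^q * L^1 → L^q then gives
exactly the second term.

The near part needs a Calderón–Zygmund theorem uniform over the kernels in `IsCZKernel K A`. The
annular support required there is qualitative: it makes K bounded and integrable, but no final
constant depends on it. Cancellation at low frequencies and the Hörmander condition at high ones
bound the Fourier transform of K (`IsCZKernel.exists_norm_fourier_le`), whence the L^2 bound by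
Plancherel. Stopping-time cubes give weak type (1,1) (`IsCZKernel.exists_weakType`), Marcinkiewicz
interpolation gives 1 < q < 2, and duality gives q > 2 (`IsCZKernel.exists_eLpNorm_le`).

That the near part qualifies is `IsDiniKernel.exists_isCZKernel`. A displacement h changes the
direction of y by at most 2|h|/|y|, and the substitution δ = 2|h|/r turns the Hörmander integral
into the Dini integral; the jumps of the cut-off at the two edges of the annulus cost only bounded
logarithmic integrals. -/

theorem lintegral_eq_lintegral_toSphere_prod [Nontrivial E] (F : E → ℝ≥0∞) :
    ∫⁻ x, F x = ∫⁻ p, F (p.2.1 • p.1.1)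
      ∂((volume : Measure E).toSphere.prod (Measure.volumeIoiPow (finrank ℝ E - 1))) := by
  -- The polar map is a measurable embedding off the null set {0}, so F need not be measurable.
  rw [← (Measure.measurePreserving_homeomorphUnitSphereProd (volume : Measure E)).lintegral_comp_emb
    (Homeomorph.measurableEmbedding _)]
  conv_lhs => rw [← restrict_compl_singleton (μ := (volume : Measure E)) 0,
    ← lintegral_subtype_comap (measurableSet_singleton _).compl]
  refine lintegral_congr fun x => ?_
  have : ‖(x : E)‖ ≠ 0 := norm_ne_zero_iff.2 x.2
  simp [smul_smul, this]

theorem integral_eq_integral_toSphere_prod [Nontrivial E] (F : E → ℝ) :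
    ∫ x, F x = ∫ p, F (p.2.1 • p.1.1)
      ∂((volume : Measure E).toSphere.prod (Measure.volumeIoiPow (finrank ℝ E - 1))) := by
  rw [← (Measure.measurePreserving_homeomorphUnitSphereProd (volume : Measure E)).integral_comp
    (Homeomorph.measurableEmbedding (homeomorphUnitSphereProd E))]
  conv_lhs => rw [← restrict_compl_singleton (μ := (volume : Measure E)) 0,
    ← integral_subtype_comap (measurableSet_singleton _).compl]
  refine integral_congr_ae (Eventually.of_forall fun x => ?_)
  have : ‖(x : E)‖ ≠ 0 := norm_ne_zero_iff.2 x.2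
  simp [smul_smul, this]

theorem lintegral_fun_norm_eq [Nontrivial E] {g : ℝ → ℝ≥0∞} (hg : Measurable g) :
    ∫⁻ x : E, g ‖x‖ = finrank ℝ E * volume (ball (0 : E) 1) *
      ∫⁻ r in Ioi (0 : ℝ), ENNReal.ofReal (r ^ (finrank ℝ E - 1)) * g r := by
  rw [lintegral_eq_lintegral_toSphere_prod]
  have h1 : ∀ p : sphere (0 : E) 1 × Ioi (0 : ℝ), g ‖p.2.1 • p.1.1‖ = g p.2.1 := by
    rintro ⟨⟨x, hx⟩, ⟨r, hr⟩⟩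
    rw [mem_Ioi] at hr
    rw [mem_sphere_zero_iff_norm] at hx
    simp [norm_smul, hx, abs_of_pos hr]
  simp only [h1]
  rw [lintegral_prod _ (by fun_prop)]
  simp only [lintegral_const, Measure.toSphere_apply_univ]
  rw [Measure.volumeIoiPow, lintegral_withDensity_eq_lintegral_mul _ (by fun_prop) (by fun_prop),
    ← lintegral_subtype_comap measurableSet_Ioi, mul_comm]
  rfl

/-- A function of degree zero with mean zero on the sphere is orthogonal to radial functions. -/
theorem integral_mul_fun_norm_eq_zero [Nontrivial E] {Ω : E → ℝ}
    (hom : ∀ r : ℝ, 0 < r → ∀ x, x ≠ 0 → Ω (r • x) = Ω x)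
    (hΩ : ∫ x : sphere (0 : E) 1, Ω x ∂(volume : Measure E).toSphere = 0) (g : ℝ → ℝ) :
    ∫ x, Ω x * g ‖x‖ = 0 := by
  rw [integral_eq_integral_toSphere_prod]
  have h1 : ∀ p : sphere (0 : E) 1 × Ioi (0 : ℝ),
      Ω (p.2.1 • p.1.1) * g ‖p.2.1 • p.1.1‖ = Ω p.1.1 * g p.2.1 := by
    rintro ⟨⟨x, hx⟩, ⟨r, hr⟩⟩
    rw [mem_Ioi] at hr
    rw [mem_sphere_zero_iff_norm] at hx
    have hx0 : x ≠ 0 := by rintro rfl; simp at hx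
    simp [norm_smul, hx, abs_of_pos hr, hom r hr x hx0]
  simp only [h1]
  -- The product formula for Bochner integrals holds without integrability, so g may be arbitrary.
  rw [integral_prod_mul (fun x : sphere (0 : E) 1 => Ω x) (fun r : Ioi (0 : ℝ) => g r), hΩ, zero_mul]

/-- The case `g(r) = r ^ (- dim E) G(r)` of integration of radial functions. -/
theorem lintegral_fun_norm_div_pow_eq [Nontrivial E] {g : ℝ → ℝ≥0∞} (hg : Measurable g) :
    ∫⁻ x : E, g ‖x‖ / ENNReal.ofReal (‖x‖ ^ finrank ℝ E) =
      finrank ℝ E * volume (ball (0 : E) 1) *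
      ∫⁻ r in Ioi (0 : ℝ), g r / ENNReal.ofReal r := by
  rw [lintegral_fun_norm_eq (g := fun r => g r / ENNReal.ofReal (r ^ finrank ℝ E)) (by fun_prop)]
  congr 1
  refine setLIntegral_congr_fun measurableSet_Ioi fun r (hr : 0 < r) => ?_
  have hd : finrank ℝ E - 1 + 1 = finrank ℝ E := Nat.succ_pred_eq_of_pos finrank_pos
  have h2 : ENNReal.ofReal (r ^ finrank ℝ E) =
      ENNReal.ofReal (r ^ (finrank ℝ E - 1)) * ENNReal.ofReal r := by
    rw [← ENNReal.ofReal_mul (by positivity), ← pow_succ, hd]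
  have h3 : ENNReal.ofReal (r ^ (finrank ℝ E - 1)) ≠ 0 := by simp; positivity
  have h4 : ENNReal.ofReal r ≠ 0 := by simp [hr]
  rw [h2, ENNReal.div_eq_inv_mul, ENNReal.mul_inv (Or.inl h3) (Or.inl ENNReal.ofReal_ne_top),
    ENNReal.div_eq_inv_mul, ← mul_assoc, ← mul_assoc,
    ENNReal.mul_inv_cancel h3 ENNReal.ofReal_ne_top, one_mul]

end Radial

/-! ### Calderón–Zygmund kernels and their Fourier transforms. -/

section CZKernel

variable {E : Type*} [NormedAddCommGroup E] [InnerProductSpace ℝ E] [FiniteDimensional ℝ E]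
  [MeasurableSpace E] [BorelSpace E]

/-- A Calderón–Zygmund convolution kernel with constant `A`, truncated to an annulus. The
Hörmander condition is required of all its truncations to the exterior of a ball. -/
structure IsCZKernel (K : E → ℝ) (A : ℝ≥0) : Prop where
  measurable : Measurable K
  size : ∀ y, |K y| * ‖y‖ ^ finrank ℝ E ≤ A
  support : ∃ a b, 0 < a ∧ ∀ y, K y ≠ 0 → a ≤ ‖y‖ ∧ ‖y‖ ≤ b
  cancel : ∀ r, ∫ y in ball (0 : E) r, K y = 0
  smooth : ∀ (s : ℝ) (h : E), ∫⁻ y in {y | 2 * ‖h‖ ≤ ‖y‖},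
    ‖{z | s ≤ ‖z‖}.indicator K (y - h) - {z | s ≤ ‖z‖}.indicator K y‖ₑ ≤ A

namespace IsCZKernel

variable {K : E → ℝ} {A : ℝ≥0}

theorem exists_bound (hK : IsCZKernel K A) : ∃ M : ℝ≥0, ∀ y, |K y| ≤ M := by
  obtain ⟨a, b, ha, hab⟩ := hK.support
  refine ⟨A / a.toNNReal ^ finrank ℝ E, fun y => ?_⟩
  by_cases hy : K y = 0
  · rw [hy, abs_zero]; positivity
  · have h1 := hK.size y
    have h2 := (hab y hy).1
    rw [NNReal.coe_div, NNReal.coe_pow, Real.coe_toNNReal _ ha.le, le_div_iff₀ (by positivity)]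
    exact (by gcongr : |K y| * a ^ finrank ℝ E ≤ |K y| * ‖y‖ ^ finrank ℝ E).trans h1

theorem integrable (hK : IsCZKernel K A) : Integrable K := by
  obtain ⟨a, b, ha, hab⟩ := hK.support
  obtain ⟨M, hM⟩ := hK.exists_bound
  rw [← integrableOn_iff_integrable_of_support_subset (s := closedBall 0 b)]
  · exact Measure.integrableOn_of_bounded (M := M) measure_closedBall_lt_top.ne
      hK.measurable.aestronglyMeasurable (Eventually.of_forall hM)
  · intro y hy
    simpa using (hab y hy).2

theorem apply_zero (hK : IsCZKernel K A) : K 0 = 0 := by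
  obtain ⟨a, b, ha, hab⟩ := hK.support
  by_contra h
  have := (hab 0 h).1
  simp at this
  linarith

theorem enorm_le (hK : IsCZKernel K A) (y : E) :
    ‖K y‖ₑ ≤ A / ENNReal.ofReal (‖y‖ ^ finrank ℝ E) := by
  by_cases hy : y = 0
  · rw [hy, hK.apply_zero]; simp
  have : 0 < ‖y‖ ^ finrank ℝ E := by positivity
  rw [ENNReal.le_div_iff_mul_le (Or.inl (ENNReal.ofReal_pos.2 this).ne') (Or.inl ENNReal.ofReal_ne_top), Real.enorm_eq_ofReal_abs,
    ← ENNReal.ofReal_mul (abs_nonneg _), ← ENNReal.ofReal_coe_nnreal]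
  exact ENNReal.ofReal_le_ofReal (hK.size y)

theorem integral_eq_zero (hK : IsCZKernel K A) : ∫ y, K y = 0 := by
  obtain ⟨a, b, ha, hab⟩ := hK.support
  rw [← hK.cancel (b + 1), setIntegral_eq_integral_of_forall_compl_eq_zero]
  intro y hy
  by_contra h
  have := (hab y h).2
  simp at hy
  linarith

/-- The reflected kernel is the kernel of the adjoint operator; it enters the duality argument for q
> 2 with the same constant. -/
theorem comp_neg (hK : IsCZKernel K A) : IsCZKernel (fun y => K (-y)) A where
  measurable := hK.measurable.comp measurable_neg
  size y := by simpa using hK.size (-y)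
  support := by
    obtain ⟨a, b, ha, hab⟩ := hK.support
    exact ⟨a, b, ha, fun y hy => by simpa using hab (-y) hy⟩
  cancel r := by
    rw [← hK.cancel r, ← integral_indicator measurableSet_ball, ← integral_indicator
      measurableSet_ball, ← integral_neg_eq_self]
    congr 1 with y
    simp [indicator]
  smooth s h := by
    refine le_trans (le_of_eq ?_) (hK.smooth s (-h))
    have hm : ∀ c : ℝ, MeasurableSet {y : E | c ≤ ‖y‖} :=
      fun c => measurableSet_le measurable_const measurable_norm
    rw [← lintegral_indicator (hm _), ← lintegral_indicator (hm _), ← lintegral_neg_eq_self]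
    congr 1 with y
    have h1 : -(-y - h) = y - -h := by abel
    have h2 : ‖-y - h‖ = ‖y - -h‖ := by rw [← h1, norm_neg]
    simp only [indicator, mem_ofPred_eq, norm_neg, neg_neg, h1, h2]

/-- Cancellation over the ball allows the character to be replaced by itself minus 1, which is at
most 2π|ξ||y|. This gains a factor |y| over the size bound A|y|^(-d), d being the dimension, so the
radial integrand is the constant 2π|ξ|A on an interval of length 1/|ξ|. -/
theorem enorm_integral_ball_le [Nontrivial E] (hK : IsCZKernel K A) {ξ : E} (hξ : ξ ≠ 0) :
    ‖∫ y in ball (0 : E) ‖ξ‖⁻¹, Complex.exp (↑(-2 * Real.pi * inner ℝ y ξ) * Complex.I) * K y‖ₑ ≤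
      finrank ℝ E * volume (ball (0 : E) 1) * (A * ENNReal.ofReal (2 * Real.pi)) := by
  have hξ' : 0 < ‖ξ‖ := norm_pos_iff.2 hξ
  have hint : Integrable fun y => (K y : ℂ) := hK.integrable.ofReal
  have h0 : ∫ y in ball (0 : E) ‖ξ‖⁻¹, (K y : ℂ) = 0 := by
    rw [integral_complex_ofReal, hK.cancel]; simp
  have hc : Continuous fun y : E =>
    Complex.exp (↑(-2 * Real.pi * inner ℝ y ξ) * Complex.I) := by fun_prop
  have hint2 : Integrable fun y : E =>
      Complex.exp (↑(-2 * Real.pi * inner ℝ y ξ) * Complex.I) * K y := by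
    refine hint.bdd_mul (c := 1) hc.aestronglyMeasurable (Eventually.of_forall fun y => ?_)
    rw [Complex.norm_exp_ofReal_mul_I]
  have h1 : ∫ y in ball (0 : E) ‖ξ‖⁻¹,
        Complex.exp (↑(-2 * Real.pi * inner ℝ y ξ) * Complex.I) * K y =
      ∫ y in ball (0 : E) ‖ξ‖⁻¹,
        (Complex.exp (↑(-2 * Real.pi * inner ℝ y ξ) * Complex.I) - 1) * K y := by
    simp only [sub_mul, one_mul]
    rw [integral_sub hint2.integrableOn hint.integrableOn, h0, sub_zero]
  rw [h1]
  refine (enorm_integral_le_lintegral_enorm _).trans ?_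
  let g : ℝ → ℝ≥0∞ := (Iio ‖ξ‖⁻¹).indicator fun r => ENNReal.ofReal (2 * Real.pi * ‖ξ‖ * r) * A
  have hg : Measurable g := by
    refine Measurable.indicator ?_ measurableSet_Iio
    fun_prop
  calc ∫⁻ y in ball (0 : E) ‖ξ‖⁻¹,
        ‖(Complex.exp (↑(-2 * Real.pi * inner ℝ y ξ) * Complex.I) - 1) * K y‖ₑ
      ≤ ∫⁻ y : E, g ‖y‖ / ENNReal.ofReal (‖y‖ ^ finrank ℝ E) := by
        rw [← lintegral_indicator measurableSet_ball]
        refine lintegral_mono fun y => ?_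
        by_cases hy : y ∈ ball (0 : E) ‖ξ‖⁻¹
        · have hy' : ‖y‖ ∈ Iio ‖ξ‖⁻¹ := by simpa using hy
          simp only [indicator_of_mem hy, g, indicator_of_mem hy']
          rw [enorm_mul, mul_div_assoc]
          gcongr
          · rw [← ofReal_norm, mul_comm _ Complex.I]
            refine ENNReal.ofReal_le_ofReal (Real.norm_exp_I_mul_ofReal_sub_one_le.trans ?_)
            rw [Real.norm_eq_abs, abs_mul, abs_mul, abs_neg, abs_two, abs_of_pos Real.pi_pos,
              mul_assoc (2 * Real.pi), mul_comm ‖ξ‖]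
            gcongr
            exact abs_real_inner_le_norm y ξ
          · refine le_trans (le_of_eq ?_) (hK.enorm_le y)
            rw [← ofReal_norm, Complex.norm_real, ofReal_norm]
        · simp [indicator_of_notMem hy]
    _ = finrank ℝ E * volume (ball (0 : E) 1) * ∫⁻ r in Ioi (0 : ℝ), g r / ENNReal.ofReal r :=
        lintegral_fun_norm_div_pow_eq hg
    _ ≤ _ := by
        gcongr
        calc ∫⁻ r in Ioi (0 : ℝ), g r / ENNReal.ofReal r
            ≤ ∫⁻ r in Ioi (0 : ℝ), (Ioo 0 ‖ξ‖⁻¹).indicator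
                (fun _ => ENNReal.ofReal (2 * Real.pi * ‖ξ‖) * A) r := by
              refine setLIntegral_mono' measurableSet_Ioi fun r (hr : 0 < r) => ?_
              by_cases h : r < ‖ξ‖⁻¹
              · have h' : r ∈ Iio ‖ξ‖⁻¹ := h
                rw [indicator_of_mem (show r ∈ Ioo 0 ‖ξ‖⁻¹ from ⟨hr, h⟩)]
                simp only [g, indicator_of_mem h']
                rw [ENNReal.ofReal_mul (by positivity), mul_right_comm,
                  ENNReal.mul_div_cancel_right (by simp [hr]) (by simp)]
              · have h' : r ∉ Iio ‖ξ‖⁻¹ := h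
                simp [g, indicator_of_notMem h']
          _ ≤ ∫⁻ r, (Ioo 0 ‖ξ‖⁻¹).indicator
                (fun _ => ENNReal.ofReal (2 * Real.pi * ‖ξ‖) * A) r := setLIntegral_le_lintegral _ _
          _ = A * ENNReal.ofReal (2 * Real.pi) := by
              rw [lintegral_indicator measurableSet_Ioo, setLIntegral_const, Real.volume_Ioo,
                mul_comm, sub_zero, ← mul_assoc, ← ENNReal.ofReal_mul (by positivity), mul_comm]
              congr 2
              field_simp

/-- Translation by h = ξ/(2|ξ|²) changes the sign of the character, so twice the integral is the
character against G(y) - G(y-h). Since 2|h| = 1/|ξ|, the Hörmander condition for the truncation G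
itself controls |y| ≥ 1/|ξ|; this is why `smooth` is imposed on all exterior truncations. On |y| <
1/|ξ| only G(y-h) survives, and it is at most A|ξ|^d on a ball whose volume is that of the unit ball
times |ξ|^(-d). -/
theorem enorm_integral_compl_ball_le [Nontrivial E] (hK : IsCZKernel K A) {ξ : E} (hξ : ξ ≠ 0) :
    ‖∫ y, Complex.exp (↑(-2 * Real.pi * inner ℝ y ξ) * Complex.I) *
      ({z | ‖ξ‖⁻¹ ≤ ‖z‖}.indicator K y : ℝ)‖ₑ ≤ A + A * volume (ball (0 : E) 1) := by
  have hξ' : 0 < ‖ξ‖ := norm_pos_iff.2 hξ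
  have hm : ∀ c : ℝ, MeasurableSet {y : E | c ≤ ‖y‖} :=
    fun c => measurableSet_le measurable_const measurable_norm
  set G := {z | ‖ξ‖⁻¹ ≤ ‖z‖}.indicator K with hG
  have hGi : Integrable fun y => (G y : ℂ) := (hK.integrable.indicator (hm _)).ofReal
  set e : E → ℂ := fun y => Complex.exp (↑(-2 * Real.pi * inner ℝ y ξ) * Complex.I) with he
  have hc : Continuous e := by fun_prop
  have hn : ∀ y, ‖e y‖ = 1 := fun y => Complex.norm_exp_ofReal_mul_I _
  have hint : ∀ F : E → ℂ, Integrable F → Integrable fun y => e y * F y := fun F hF =>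
    hF.bdd_mul (c := 1) hc.aestronglyMeasurable (Eventually.of_forall fun y => (hn y).le)
  set h : E := ((2 * ‖ξ‖ ^ 2)⁻¹ : ℝ) • ξ with hh
  have hhn : 2 * ‖h‖ = ‖ξ‖⁻¹ := by
    rw [hh, norm_smul, Real.norm_of_nonneg (by positivity)]; field_simp
  have hhi : inner ℝ h ξ = 1 / 2 := by
    rw [hh, inner_smul_left, real_inner_self_eq_norm_sq]; simp; field_simp
  have hshift : ∀ y, e (y - h) = - e y := by
    intro y
    simp only [he, inner_sub_left, hhi]
    rw [show ((-2 * Real.pi * (inner ℝ y ξ - 1 / 2) : ℝ) : ℂ) * Complex.I =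
      ((-2 * Real.pi * inner ℝ y ξ : ℝ) : ℂ) * Complex.I + Real.pi * Complex.I by
        push_cast; ring, Complex.exp_add, Complex.exp_pi_mul_I]
    ring
  have h1 : ∫ y, e y * (G y : ℂ) = - ∫ y, e y * (G (y - h) : ℂ) := by
    rw [← integral_sub_right_eq_self _ h, ← integral_neg]
    simp only [hshift, neg_mul]
  have h2 : 2 * ∫ y, e y * (G y : ℂ) = ∫ y, e y * ((G y : ℂ) - G (y - h)) := by
    simp only [mul_sub]
    rw [integral_sub (hint _ hGi) (hint _ (hGi.comp_sub_right h)), two_mul]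
    nth_rewrite 2 [h1]
    ring
  -- The factor 1/2 gained from the symmetrization is simply discarded.
  have h3 : ‖∫ y, e y * (G y : ℂ)‖ₑ ≤ ‖2 * ∫ y, e y * (G y : ℂ)‖ₑ := by
    rw [← ofReal_norm, ← ofReal_norm]
    refine ENNReal.ofReal_le_ofReal ?_
    rw [norm_mul, Complex.norm_two]
    linarith [norm_nonneg (∫ y, e y * (G y : ℂ))]
  refine h3.trans ?_
  rw [h2]
  refine (enorm_integral_le_lintegral_enorm _).trans ?_
  have h4 : ∀ y, ‖e y * ((G y : ℂ) - G (y - h))‖ₑ = ‖G (y - h) - G y‖ₑ := by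
    intro y
    rw [← ofReal_norm, ← ofReal_norm, norm_mul, hn, one_mul, ← Complex.ofReal_sub,
      Complex.norm_real, norm_sub_rev]
  simp only [h4]
  rw [← lintegral_add_compl _ (hm ‖ξ‖⁻¹)]
  gcongr
  · have := hK.smooth ‖ξ‖⁻¹ h
    rwa [hhn] at this
  · have hsub : {y : E | ‖ξ‖⁻¹ ≤ ‖y‖}ᶜ = ball 0 ‖ξ‖⁻¹ := by ext; simp
    have hr : 0 < ‖ξ‖⁻¹ ^ finrank ℝ E := by positivity
    calc ∫⁻ y in {y : E | ‖ξ‖⁻¹ ≤ ‖y‖}ᶜ, ‖G (y - h) - G y‖ₑ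
        ≤ ∫⁻ y in {y : E | ‖ξ‖⁻¹ ≤ ‖y‖}ᶜ, A / ENNReal.ofReal (‖ξ‖⁻¹ ^ finrank ℝ E) := by
          refine setLIntegral_mono' (hm _).compl fun y hy => ?_
          have : G y = 0 := indicator_of_notMem hy _
          rw [this, sub_zero]
          by_cases hyh : y - h ∈ {z | ‖ξ‖⁻¹ ≤ ‖z‖}
          · rw [hG, indicator_of_mem hyh]
            refine (hK.enorm_le _).trans ?_
            gcongr
            exact hyh
          · rw [hG, indicator_of_notMem hyh]; simp
      _ = A * volume (ball (0 : E) 1) := by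
          rw [setLIntegral_const, hsub, Measure.addHaar_ball_of_pos _ _ (by positivity),
            ← mul_assoc, ENNReal.div_mul_cancel (by simp; positivity) (by simp)]

theorem exists_norm_fourier_le [Nontrivial E] (A : ℝ≥0) : ∃ C : ℝ≥0, ∀ K : E → ℝ,
    IsCZKernel K A → ∀ ξ : E, ‖𝓕 (fun y => (K y : ℂ)) ξ‖ ≤ C := by
  have hv : volume (ball (0 : E) 1) ≠ ∞ := measure_ball_lt_top.ne
  refine ⟨(finrank ℝ E * volume (ball (0 : E) 1) * (A * ENNReal.ofReal (2 * Real.pi)) +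
    (A + A * volume (ball (0 : E) 1))).toNNReal, fun K hK ξ => ?_⟩
  rw [← toReal_enorm]
  refine ENNReal.toReal_mono (by finiteness) ?_
  rw [Real.fourier_eq']
  simp only [smul_eq_mul]
  by_cases hξ : ξ = 0
  · have : ∫ y, (K y : ℂ) = 0 := by rw [integral_complex_ofReal, hK.integral_eq_zero]; simp
    simp [hξ, this]
  have hm : MeasurableSet {y : E | ‖ξ‖⁻¹ ≤ ‖y‖} := measurableSet_le measurable_const measurable_norm
  have hint2 : Integrable fun y : E =>
      Complex.exp (↑(-2 * Real.pi * inner ℝ y ξ) * Complex.I) * K y := by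
    refine hK.integrable.ofReal.bdd_mul (c := 1) (by fun_prop) (Eventually.of_forall fun y => ?_)
    rw [Complex.norm_exp_ofReal_mul_I]
  have hsub : {y : E | ‖ξ‖⁻¹ ≤ ‖y‖} = (ball 0 ‖ξ‖⁻¹)ᶜ := by ext; simp
  rw [← integral_add_compl measurableSet_ball (s := ball 0 ‖ξ‖⁻¹) hint2]
  refine (enorm_add_le _ _).trans (add_le_add (hK.enorm_integral_ball_le hξ) ?_)
  refine le_trans (le_of_eq ?_) (hK.enorm_integral_compl_ball_le hξ)
  rw [← hsub, ← integral_indicator hm]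
  congr 2 with y
  by_cases hy : y ∈ {y : E | ‖ξ‖⁻¹ ≤ ‖y‖}
  · simp only [indicator_of_mem hy]
  · simp only [indicator_of_notMem hy]; simp

end IsCZKernel

end CZKernel

/-! ### Young's inequality and elementary properties of convolution. -/

section Young

variable {E : Type*} [NormedAddCommGroup E] [InnerProductSpace ℝ E] [FiniteDimensional ℝ E]
  [MeasurableSpace E] [BorelSpace E]

theorem aemeasurable_comp_sub {k : E → ℝ≥0∞} (hk : AEMeasurable k) (x : E) :
    AEMeasurable fun y => k (x - y) :=
  hk.comp_quasiMeasurePreserving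
    (quasiMeasurePreserving_sub_left_of_right_invariant (volume : Measure E) x)

theorem aemeasurable_convolution_integrand {k f : E → ℝ≥0∞} (hk : AEMeasurable k)
    (hf : AEMeasurable f) : AEMeasurable (fun p : E × E => k (p.1 - p.2) * f p.2)
      ((volume : Measure E).prod volume) :=
  (hk.comp_quasiMeasurePreserving (quasiMeasurePreserving_sub volume volume)).mul hf.comp_snd

/-- Young's inequality `L^p * L^1 → L^p` for nonnegative functions. -/
theorem lintegral_convolution_rpow_le {k f : E → ℝ≥0∞} (hk : AEMeasurable k) (hf : AEMeasurable f)
    {p : ℝ} (hp : 1 ≤ p) :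
    ∫⁻ x, (∫⁻ y, k (x - y) * f y) ^ p ≤ (∫⁻ x, k x ^ p) * (∫⁻ y, f y) ^ p := by
  have hp0 : 0 < p := by linarith
  have hkp : AEMeasurable fun x => k x ^ p := hk.pow_const p
  have h1 : ∀ x, (∫⁻ y, k (x - y) * f y) ^ p ≤
      (∫⁻ y, k (x - y) ^ p * f y) * (∫⁻ y, f y) ^ (p - 1) := by
    intro x
    have h2 := ENNReal.lintegral_mul_norm_pow_le (μ := (volume : Measure E))
      ((aemeasurable_comp_sub hkp x).mul hf) hf (p := p⁻¹) (q := 1 - p⁻¹) (by positivity)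
      (by rw [sub_nonneg]; exact inv_le_one_of_one_le₀ hp) (by ring)
    -- Hölder is applied with f split as f^(1/p) f^(1-1/p), so that the p-th power falls on k alone.
    have h3 : ∀ y, k (x - y) * f y ≤ (k (x - y) ^ p * f y) ^ p⁻¹ * f y ^ (1 - p⁻¹) := by
      intro y
      rw [ENNReal.mul_rpow_of_nonneg _ _ (by positivity), ENNReal.rpow_rpow_inv hp0.ne', mul_assoc,
        ← ENNReal.rpow_add_of_nonneg _ _ (by positivity)
          (by rw [sub_nonneg]; exact inv_le_one_of_one_le₀ hp)]
      simp
    calc (∫⁻ y, k (x - y) * f y) ^ p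
        ≤ ((∫⁻ y, k (x - y) ^ p * f y) ^ p⁻¹ * (∫⁻ y, f y) ^ (1 - p⁻¹)) ^ p := by
          gcongr
          exact (lintegral_mono h3).trans h2
      _ = _ := by
          rw [ENNReal.mul_rpow_of_nonneg _ _ hp0.le, ENNReal.rpow_inv_rpow hp0.ne',
            ← ENNReal.rpow_mul]
          congr 2
          field_simp
  have hm := aemeasurable_convolution_integrand hkp hf
  calc ∫⁻ x, (∫⁻ y, k (x - y) * f y) ^ p
      ≤ ∫⁻ x, (∫⁻ y, k (x - y) ^ p * f y) * (∫⁻ y, f y) ^ (p - 1) := lintegral_mono h1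
    _ = (∫⁻ x, ∫⁻ y, k (x - y) ^ p * f y) * (∫⁻ y, f y) ^ (p - 1) :=
        lintegral_mul_const'' _ hm.lintegral_prod_right'
    _ = (∫⁻ y, ∫⁻ x, k (x - y) ^ p * f y) * (∫⁻ y, f y) ^ (p - 1) := by
        rw [lintegral_lintegral_swap hm]
    _ = (∫⁻ y, (∫⁻ x, k x ^ p) * f y) * (∫⁻ y, f y) ^ (p - 1) := by
        congr 2 with y
        have hky : AEMeasurable fun x => k (x - y) ^ p := hkp.comp_quasiMeasurePreserving
          (measurePreserving_sub_right volume y).quasiMeasurePreserving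
        rw [lintegral_mul_const'' _ hky,
          lintegral_sub_right_eq_self (fun x => k x ^ p) y]
    _ = (∫⁻ x, k x ^ p) * (∫⁻ y, f y) ^ p := by
        rw [lintegral_const_mul'' _ hf, mul_assoc]
        congr 1
        nth_rewrite 1 [← ENNReal.rpow_one (∫⁻ y, f y)]
        rw [← ENNReal.rpow_add_of_nonneg _ _ zero_le_one (by linarith)]
        congr 1; ring

variable {𝕜 : Type*} [RCLike 𝕜]

/-- The convolution `K * f`. -/
noncomputable def convOp (K f : E → 𝕜) (x : E) : 𝕜 := ∫ y, K (x - y) * f y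

theorem convOp_eq_integral_swap (K f : E → 𝕜) (x : E) : convOp K f x = ∫ y, K y * f (x - y) := by
  rw [convOp, ← integral_sub_left_eq_self _ volume x]
  simp

theorem aestronglyMeasurable_convOp {K f : E → 𝕜} (hK : AEStronglyMeasurable K)
    (hf : AEStronglyMeasurable f) : AEStronglyMeasurable (convOp K f) :=
  ((hK.comp_quasiMeasurePreserving (quasiMeasurePreserving_sub volume volume)).mul
    hf.comp_snd).integral_prod_right'

theorem enorm_convOp_le (K f : E → 𝕜) (x : E) :
    ‖convOp K f x‖ₑ ≤ ∫⁻ y, ‖K (x - y)‖ₑ * ‖f y‖ₑ := by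
  refine (enorm_integral_le_lintegral_enorm _).trans_eq ?_
  simp only [enorm_mul]

theorem eLpNorm_convOp_le_left {K f : E → 𝕜} (hK : AEStronglyMeasurable K)
    (hf : AEStronglyMeasurable f) {p : ℝ} (hp : 1 ≤ p) :
    eLpNorm (convOp K f) (ENNReal.ofReal p) ≤
      eLpNorm K (ENNReal.ofReal p) * eLpNorm f 1 := by
  have hp0 : 0 < p := by linarith
  rw [eLpNorm_eq_lintegral_rpow_enorm_toReal (by simp [hp0]) (by simp),
    eLpNorm_eq_lintegral_rpow_enorm_toReal (by simp [hp0]) (by simp), eLpNorm_one_eq_lintegral_enorm,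
    ENNReal.toReal_ofReal hp0.le]
  calc (∫⁻ x, ‖convOp K f x‖ₑ ^ p) ^ (1 / p)
      ≤ ((∫⁻ x, ‖K x‖ₑ ^ p) * (∫⁻ y, ‖f y‖ₑ) ^ p) ^ (1 / p) := by
        gcongr
        refine le_trans ?_ (lintegral_convolution_rpow_le hK.enorm hf.enorm hp)
        gcongr
        exact enorm_convOp_le K f _
    _ = _ := by
        rw [ENNReal.mul_rpow_of_nonneg _ _ (by positivity), ← ENNReal.rpow_mul,
          mul_one_div_cancel hp0.ne', ENNReal.rpow_one]

theorem convOp_comm (K f : E → 𝕜) : convOp K f = convOp f K := by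
  ext x
  rw [convOp_eq_integral_swap, convOp]
  simp only [mul_comm]

theorem eLpNorm_convOp_le_right {K f : E → 𝕜} (hK : AEStronglyMeasurable K)
    (hf : AEStronglyMeasurable f) {p : ℝ} (hp : 1 ≤ p) :
    eLpNorm (convOp K f) (ENNReal.ofReal p) ≤
      eLpNorm K 1 * eLpNorm f (ENNReal.ofReal p) := by
  rw [convOp_comm, mul_comm]
  exact eLpNorm_convOp_le_left hf hK hp

/-- Only finiteness matters here: the bound involves ‖K‖₁, which is not uniform over
Calderón–Zygmund kernels. -/
theorem memLp_convOp {K f : E → 𝕜} (hK : Integrable K) {p : ℝ} (hp : 1 ≤ p)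
    (hf : MemLp f (ENNReal.ofReal p)) : MemLp (convOp K f) (ENNReal.ofReal p) :=
  ⟨aestronglyMeasurable_convOp hK.1 hf.1, (eLpNorm_convOp_le_right hK.1 hf.1 hp).trans_lt
    (ENNReal.mul_lt_top (memLp_one_iff_integrable.2 hK).2 hf.2)⟩

theorem integrable_convOp {K f : E → 𝕜} (hK : Integrable K) (hf : Integrable f) :
    Integrable (convOp K f) := by
  have := memLp_convOp hK le_rfl (f := f) (by simpa [memLp_one_iff_integrable] using hf)
  simpa [memLp_one_iff_integrable] using this

theorem convOp_congr_ae {K f g : E → 𝕜} (h : f =ᵐ[volume] g) : convOp K f = convOp K g := by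
  ext x
  refine integral_congr_ae ?_
  filter_upwards [h] with y hy
  rw [hy]

end Young

/-! ### Plancherel and the L² bound on Schwartz functions. -/

section LTwo

variable {E : Type*} [NormedAddCommGroup E] [InnerProductSpace ℝ E] [FiniteDimensional ℝ E]
  [MeasurableSpace E] [BorelSpace E]

/-- Plancherel's identity for continuous integrable functions with integrable Fourier transform. -/
theorem integral_norm_sq_fourier_eq {g : E → ℂ} (hc : Continuous g) (hg : Integrable g)
    (hg' : Integrable (𝓕 g)) : ∫ ξ, ‖𝓕 g ξ‖ ^ 2 = ∫ x, ‖g x‖ ^ 2 := by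
  -- Moving one Fourier transform across the pairing turns it into the inverse transform of 𝓕 g,
  -- which inversion identifies with g.
  have h : ∫ ξ, innerSL ℂ (𝓕 g ξ) (𝓕 g ξ) = ∫ x, innerSL ℂ (g x) (𝓕⁻ (𝓕 g) x) := by
    have := VectorFourier.integral_sesq_fourierIntegral_eq_neg_flip (innerSL ℂ) (L := innerₗ E)
      Real.continuous_fourierChar continuous_inner hg hg'
    rwa [flip_innerₗ] at this
  rw [hc.fourierInv_fourier_eq hg hg'] at h
  apply Complex.ofRealLI.injective
  simpa [← LinearIsometry.integral_comp_comm, inner_self_eq_norm_sq_to_K] using h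

theorem eLpNorm_two_eq_ofReal_integral {f : E → ℂ} (hf : MemLp f 2) :
    eLpNorm f 2 = ENNReal.ofReal ((∫ x, ‖f x‖ ^ 2) ^ (2⁻¹ : ℝ)) := by
  rw [hf.eLpNorm_eq_integral_rpow_norm (by simp) (by simp)]
  simp

/-- For Schwartz S the transform 𝓕 K · 𝓕 S is integrable and K * S is continuous, so Plancherel
applies to both S and K * S, and the multiplier is at most C pointwise. -/
theorem eLpNorm_convOp_schwartz_le {K : E → ℂ} (hK : Integrable K) {C : ℝ≥0}
    (hC : ∀ ξ, ‖𝓕 K ξ‖ ≤ C) (S : SchwartzMap E ℂ) :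
    eLpNorm (convOp K S) 2 ≤ C * eLpNorm S 2 := by
  have hSi : Integrable S := S.integrable
  have hconv : convOp K S = MeasureTheory.convolution K S (ContinuousLinearMap.mul ℂ ℂ) volume := by
    ext x
    rw [convOp_eq_integral_swap]
    rfl
  have hcont : Continuous (convOp K S) := by
    rw [hconv]
    refine BddAbove.continuous_convolution_right_of_integrable _ ?_ hK S.continuous
    obtain ⟨M, hM⟩ := S.toBoundedContinuousFunction.bddAbove_range_norm_comp
    exact ⟨M, hM⟩
  have hint : Integrable (convOp K S) := integrable_convOp hK hSi
  have hF : 𝓕 (convOp K S) = fun ξ => 𝓕 K ξ * 𝓕 (S : E → ℂ) ξ := by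
    ext ξ
    rw [hconv, Real.fourier_mul_convolution_eq hK hSi]
  have hSF : (𝓕 (S : E → ℂ)) = ((𝓕 S : SchwartzMap E ℂ) : E → ℂ) := (SchwartzMap.fourier_coe S).symm
  have hKc : Continuous (𝓕 K) :=
    VectorFourier.fourierIntegral_continuous Real.continuous_fourierChar
      (L := innerₗ E) continuous_inner hK
  have hFint : Integrable (𝓕 (convOp K S)) := by
    rw [hF, hSF]
    exact (𝓕 S : SchwartzMap E ℂ).integrable.bdd_mul (c := C) hKc.aestronglyMeasurable
      (Eventually.of_forall hC)
  have hS2 : MemLp S 2 := S.memLp 2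
  have hg2 : MemLp (convOp K S) 2 := by
    have := memLp_convOp hK one_le_two (f := S) (by simpa using hS2)
    simpa using this
  rw [eLpNorm_two_eq_ofReal_integral hg2, eLpNorm_two_eq_ofReal_integral hS2,
    ← ENNReal.ofReal_coe_nnreal, ← ENNReal.ofReal_mul C.coe_nonneg]
  refine ENNReal.ofReal_le_ofReal ?_
  rw [← integral_norm_sq_fourier_eq hcont hint hFint]
  have hle : ∫ ξ, ‖𝓕 (convOp K S) ξ‖ ^ 2 ≤ C ^ 2 * ∫ x, ‖S x‖ ^ 2 := by
    rw [← SchwartzMap.integral_norm_sq_fourier, ← integral_const_mul]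
    refine integral_mono_of_nonneg (Eventually.of_forall fun ξ => by positivity) ?_
      (Eventually.of_forall fun ξ => ?_)
    · exact ((memLp_two_iff_integrable_sq_norm (𝓕 S : SchwartzMap E ℂ).continuous.aestronglyMeasurable).1
        ((𝓕 S : SchwartzMap E ℂ).memLp 2)).const_mul _
    · simp only [hF, hSF]
      rw [norm_mul, mul_pow]
      gcongr
      exact hC ξ
  calc (∫ ξ, ‖𝓕 (convOp K S) ξ‖ ^ 2) ^ (2⁻¹ : ℝ) ≤ (C ^ 2 * ∫ x, ‖S x‖ ^ 2) ^ (2⁻¹ : ℝ) :=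
        Real.rpow_le_rpow (by positivity) hle (by norm_num)
    _ = C * (∫ x, ‖S x‖ ^ 2) ^ (2⁻¹ : ℝ) := by
        rw [Real.mul_rpow (by positivity) (by positivity), ← Real.rpow_natCast, ← Real.rpow_mul C.coe_nonneg]
        simp

theorem convOp_sub {𝕜 : Type*} [RCLike 𝕜] {K f g : E → 𝕜} {M : ℝ} (hK : AEStronglyMeasurable K)
    (hM : ∀ x, ‖K x‖ ≤ M) (hf : Integrable f) (hg : Integrable g) (x : E) :
    convOp K (f - g) x = convOp K f x - convOp K g x := by
  have hKx : AEStronglyMeasurable fun y => K (x - y) := hK.comp_quasiMeasurePreserving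
    (quasiMeasurePreserving_sub_left_of_right_invariant volume x)
  simp only [convOp, Pi.sub_apply, mul_sub]
  exact integral_sub (hf.bdd_mul hKx (Eventually.of_forall fun y => hM (x - y)))
    (hg.bdd_mul hKx (Eventually.of_forall fun y => hM (x - y)))

end LTwo

/-! ### The L² bound on L¹ ∩ L². -/

section LTwoBound

variable {E : Type*} [NormedAddCommGroup E] [InnerProductSpace ℝ E] [FiniteDimensional ℝ E]
  [MeasurableSpace E] [BorelSpace E]

/-- Density of Schwartz functions in L²: the error is controlled by Young with the constant ‖K‖₁,
which disappears in the limit and leaves only C. -/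
theorem eLpNorm_convOp_two_le {K : E → ℂ} (hK : Integrable K) {M : ℝ} (hM : ∀ x, ‖K x‖ ≤ M)
    {C : ℝ≥0} (hC : ∀ ξ, ‖𝓕 K ξ‖ ≤ C) {f : E → ℂ} (hf : Integrable f) (hf2 : MemLp f 2) :
    eLpNorm (convOp K f) 2 ≤ C * eLpNorm f 2 := by
  have hK1 : eLpNorm K 1 ≠ ∞ := (memLp_one_iff_integrable.2 hK).2.ne
  refine ENNReal.le_of_forall_pos_le_add fun ε hε _ => ?_
  -- An L² error ε/B costs ‖K‖₁ ε/B through Young and C ε/B through the norm of S; B dominates ‖K‖₁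
  -- + C and the extra 1 keeps it nonzero.
  obtain ⟨B, hB⟩ : ∃ B : ℝ≥0∞, B = eLpNorm K 1 + C + 1 := ⟨_, rfl⟩
  have hB' : B ≠ ∞ := by rw [hB]; finiteness
  have hB0 : B ≠ 0 := by simp [hB]
  have hδ : 0 < (ε / B).toReal :=
    ENNReal.toReal_pos (by simp [hε.ne', hB']) (ENNReal.div_ne_top (by simp) hB0)
  obtain ⟨S, hg₃⟩ : ∃ S : SchwartzMap E ℂ, eLpNorm (f - (S : E → ℂ)) 2 ≤ ε / B := by
    obtain ⟨g, hg₁, hg₂, hg₃⟩ := MemLp.exist_eLpNorm_sub_le (by simp) (by norm_num) hf2 hδ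
    rw [ENNReal.ofReal_toReal (ENNReal.div_ne_top (by simp) hB0)] at hg₃
    exact ⟨hg₁.toSchwartzMap hg₂, hg₃⟩
  have hS2 : MemLp S 2 := S.memLp 2
  have hsub : convOp K f = convOp K (f - (S : E → ℂ)) + convOp K S := by
    ext x
    rw [Pi.add_apply, convOp_sub hK.1 hM hf S.integrable]
    ring
  have hS3 : eLpNorm S 2 ≤ eLpNorm f 2 + ε / B := by
    have : (S : E → ℂ) = f - (f - (S : E → ℂ)) := by simp
    rw [this]
    exact (eLpNorm_sub_le hf2.1 (hf2.sub hS2).1 one_le_two).trans (by gcongr)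
  have hY : eLpNorm (convOp K (f - (S : E → ℂ))) 2 ≤ eLpNorm K 1 * eLpNorm (f - (S : E → ℂ)) 2 := by
    simpa using eLpNorm_convOp_le_right hK.1 (hf2.sub hS2).1 one_le_two
  have h1 : eLpNorm (convOp K f) 2 ≤
      eLpNorm (convOp K (f - (S : E → ℂ))) 2 + eLpNorm (convOp K S) 2 := by
    rw [hsub]
    exact eLpNorm_add_le (aestronglyMeasurable_convOp hK.1 (hf2.sub hS2).1)
      (aestronglyMeasurable_convOp hK.1 hS2.1) one_le_two
  have h2 := eLpNorm_convOp_schwartz_le hK hC S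
  generalize eLpNorm (convOp K f) 2 = a at *
  generalize eLpNorm (convOp K (f - (S : E → ℂ))) 2 = a₁ at *
  generalize eLpNorm (convOp K S) 2 = a₂ at *
  generalize eLpNorm (f - (S : E → ℂ)) 2 = d at *
  generalize eLpNorm S 2 = σ at *
  generalize eLpNorm f 2 = φ at *
  generalize eLpNorm K 1 = κ at *
  calc a ≤ a₁ + a₂ := h1
    _ ≤ κ * (ε / B) + C * (φ + ε / B) := by gcongr; exacts [hY.trans (by gcongr), h2.trans (by gcongr)]
    _ = C * φ + (κ + C) * (ε / B) := by ring
    _ ≤ C * φ + B * (ε / B) := by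
        gcongr
        rw [hB]
        exact le_self_add
    _ = C * φ + ε := by rw [ENNReal.mul_div_cancel hB0 hB']

theorem convOp_ofReal (K f : E → ℝ) (x : E) :
    convOp (fun y => (K y : ℂ)) (fun y => (f y : ℂ)) x = (convOp K f x : ℝ) := by
  simp only [convOp, ← Complex.ofReal_mul, integral_complex_ofReal]

theorem IsCZKernel.exists_eLpNorm_two_le [Nontrivial E] (A : ℝ≥0) : ∃ C : ℝ≥0, ∀ K : E → ℝ,
    IsCZKernel K A → ∀ f : E → ℝ, Integrable f → MemLp f 2 →
      eLpNorm (convOp K f) 2 ≤ C * eLpNorm f 2 := by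
  obtain ⟨C, hC⟩ := IsCZKernel.exists_norm_fourier_le (E := E) A
  refine ⟨C, fun K hK f hf hf2 => ?_⟩
  obtain ⟨M, hM⟩ := hK.exists_bound
  have := eLpNorm_convOp_two_le (K := fun y => (K y : ℂ)) hK.integrable.ofReal (M := M)
    (fun x => by simpa using hM x) (hC K hK) (f := fun y => (f y : ℂ)) hf.ofReal hf2.ofReal
  rw [eLpNorm_congr_norm_ae (g := convOp K f) (Eventually.of_forall fun x => by
    rw [convOp_ofReal, Complex.norm_real]), eLpNorm_congr_norm_ae (f := fun y => (f y : ℂ)) (g := f)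
    (Eventually.of_forall fun x => by rw [Complex.norm_real])] at this
  exact this

end LTwoBound

/-! ### Dyadic cubes and the stopping-time selection. -/

section DyadicCubes

variable {n : ℕ}

/-- The position of `x` in the grid of cubes of side length `s / 2 ^ k`. -/
noncomputable def dyadicIndex (s : ℝ) (k : ℕ) (x : EuclideanSpace ℝ (Fin n)) : Fin n → ℤ :=
  fun i => ⌊x i / (s / 2 ^ k)⌋

/-- The half-open cubes of side length `s / 2 ^ k`. -/
def dyadicCube (s : ℝ) (k : ℕ) (m : Fin n → ℤ) : Set (EuclideanSpace ℝ (Fin n)) :=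
  {x | dyadicIndex s k x = m}

theorem dyadicIndex_eq_succ_div (s : ℝ) (k : ℕ) (x : EuclideanSpace ℝ (Fin n)) (i : Fin n) :
    dyadicIndex s k x i = dyadicIndex s (k + 1) x i / 2 := by
  simp only [dyadicIndex]
  have h : x i / (s / 2 ^ k) = x i / (s / 2 ^ (k + 1)) / (2 : ℕ) := by
    rw [pow_succ, div_div_eq_mul_div, div_div_eq_mul_div, ← mul_assoc]
    push_cast
    rw [div_div, mul_div_mul_right _ _ two_ne_zero]
  rw [h, Int.floor_div_natCast]
  rfl

theorem dyadicIndex_eq_of_le {s : ℝ} {j k : ℕ} (hjk : j ≤ k) {x y : EuclideanSpace ℝ (Fin n)}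
    (h : dyadicIndex s k x = dyadicIndex s k y) : dyadicIndex s j x = dyadicIndex s j y := by
  induction k, hjk using Nat.le_induction with
  | base => exact h
  | succ k _ ih =>
    refine ih ?_
    ext i
    rw [dyadicIndex_eq_succ_div s k x, dyadicIndex_eq_succ_div s k y, h]

theorem dyadicCube_eq_preimage {s : ℝ} (hs : 0 < s) (k : ℕ) (m : Fin n → ℤ) :
    dyadicCube s k m = (MeasurableEquiv.toLp 2 (Fin n → ℝ)).symm ⁻¹'
      univ.pi fun i => Ico (m i * (s / 2 ^ k)) ((m i + 1) * (s / 2 ^ k)) := by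
  have hl : 0 < s / 2 ^ k := by positivity
  ext x
  simp only [dyadicCube, dyadicIndex, funext_iff, Int.floor_eq_iff, mem_preimage, mem_univ_pi,
    mem_Ico, mem_ofPred_eq]
  refine forall_congr' fun i => ?_
  rw [le_div_iff₀ hl, div_lt_iff₀ hl]
  rfl

theorem measurableSet_dyadicCube {s : ℝ} (hs : 0 < s) (k : ℕ) (m : Fin n → ℤ) :
    MeasurableSet (dyadicCube s k m) := by
  rw [dyadicCube_eq_preimage hs]
  exact (MeasurableEquiv.measurable _) (MeasurableSet.univ_pi fun i => measurableSet_Ico)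

theorem volume_dyadicCube {s : ℝ} (hs : 0 < s) (k : ℕ) (m : Fin n → ℤ) :
    volume (dyadicCube s k m) = ENNReal.ofReal ((s / 2 ^ k) ^ n) := by
  rw [dyadicCube_eq_preimage hs,
    (EuclideanSpace.volume_preserving_symm_measurableEquiv_toLp (Fin n)).measure_preimage
      (MeasurableSet.univ_pi fun i => measurableSet_Ico).nullMeasurableSet, Real.volume_pi_Ico]
  have : ∀ i, (m i + 1) * (s / 2 ^ k) - m i * (s / 2 ^ k) = s / 2 ^ k := fun i => by ring
  simp only [this, Finset.prod_const, Finset.card_univ, Fintype.card_fin]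
  rw [ENNReal.ofReal_pow (by positivity)]

theorem norm_sub_le_of_dyadicIndex_eq {s : ℝ} (hs : 0 < s) {k : ℕ} {x y : EuclideanSpace ℝ (Fin n)}
    (h : dyadicIndex s k x = dyadicIndex s k y) : ‖x - y‖ ≤ √n * (s / 2 ^ k) := by
  have hl : 0 < s / 2 ^ k := by positivity
  have hi : ∀ i, ‖(x - y) i‖ ≤ s / 2 ^ k := by
    intro i
    have h1 := congrFun h i
    simp only [dyadicIndex] at h1
    have h2 := Int.abs_sub_lt_one_of_floor_eq_floor h1
    rw [← sub_div, abs_div, abs_of_pos hl, div_lt_one hl] at h2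
    exact h2.le
  rw [EuclideanSpace.norm_eq]
  calc √(∑ i, ‖(x - y) i‖ ^ 2) ≤ √(∑ i : Fin n, (s / 2 ^ k) ^ 2) := by
        gcongr with i
        exact hi i
    _ = √n * (s / 2 ^ k) := by
        rw [Finset.sum_const, Finset.card_univ, Fintype.card_fin, nsmul_eq_mul,
          Real.sqrt_mul (by positivity), Real.sqrt_sq hl.le]

/-- Lebesgue differentiation: the cube of side s/2^k containing x lies in the ball of radius √n
s/2^k about x, whose volume is a fixed multiple of the cube's. Hence |f x| exceeds the cube average
of |f| by at most that multiple of the ball average of |f - f x|, which tends to 0 almost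
everywhere. -/
theorem ae_enorm_le_of_forall_dyadicCube (hn : 1 ≤ n) {f : EuclideanSpace ℝ (Fin n) → ℝ}
    (hf : Integrable f) {s : ℝ} (hs : 0 < s) (t : ℝ≥0) :
    ∀ᵐ x, (∀ k, ∫⁻ y in dyadicCube s k (dyadicIndex s k x), ‖f y‖ₑ ≤
      t * volume (dyadicCube s k (dyadicIndex s k x))) → ‖f x‖ₑ ≤ t := by
  have : Nonempty (Fin n) := ⟨⟨0, hn⟩⟩
  filter_upwards [IsUnifLocDoublingMeasure.ae_tendsto_average_norm_sub
    (volume : Measure (EuclideanSpace ℝ (Fin n))) hf.locallyIntegrable 1] with x hx hk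
  have hn0 : 0 < √(n : ℝ) := by positivity
  have hlim : Tendsto (fun k : ℕ => √n * (s / 2 ^ k)) atTop (𝓝[>] 0) := by
    rw [tendsto_nhdsWithin_iff]
    refine ⟨?_, Eventually.of_forall fun k => mem_Ioi.2 (by positivity)⟩
    have : Tendsto (fun k : ℕ => √n * s * (1 / 2 : ℝ) ^ k) atTop (𝓝 (√n * s * 0)) :=
      (tendsto_pow_atTop_nhds_zero_of_lt_one (by norm_num) (by norm_num)).const_mul _
    rw [mul_zero] at this
    refine this.congr fun k => ?_
    rw [one_div, inv_pow]
    ring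
  have hav := hx (fun _ : ℕ => x) (fun k : ℕ => √n * (s / 2 ^ k)) hlim
    (Eventually.of_forall fun k => by simp; positivity)
  -- The ratio of the volume of the ball to that of the cube, the same at every scale.
  set D : ℝ := √n ^ n * volume.real (ball (0 : EuclideanSpace ℝ (Fin n)) 1)
  have hav2 := (hav.const_mul D).const_add (t : ℝ)
  rw [mul_zero, add_zero] at hav2
  suffices h : |f x| ≤ t by
    rw [← ofReal_norm, ← ENNReal.ofReal_coe_nnreal]
    exact ENNReal.ofReal_le_ofReal h
  refine ge_of_tendsto' hav2 fun k => ?_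
  set Q := dyadicCube s k (dyadicIndex s k x) with hQ
  set B := closedBall x (√n * (s / 2 ^ k)) with hB
  have hl : 0 < (s / 2 ^ k) ^ n := by positivity
  have hQm : MeasurableSet Q := measurableSet_dyadicCube hs _ _
  have hQv : volume.real Q = (s / 2 ^ k) ^ n := by
    rw [measureReal_def, volume_dyadicCube hs, ENNReal.toReal_ofReal hl.le]
  have hQfin : volume Q ≠ ∞ := by rw [volume_dyadicCube hs]; simp
  have hQB : Q ⊆ B := fun y hy => by
    rw [hB, mem_closedBall, dist_eq_norm]
    exact norm_sub_le_of_dyadicIndex_eq hs hy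
  have hBv : volume.real B = D * (s / 2 ^ k) ^ n := by
    rw [measureReal_def, Measure.addHaar_closedBall _ _ (by positivity), ENNReal.toReal_mul,
      ENNReal.toReal_ofReal (by positivity), finrank_euclideanSpace_fin, mul_pow, ← measureReal_def]
    ring
  have hBfin : volume B ≠ ∞ := measure_closedBall_lt_top.ne
  have hconst : ∀ s : Set (EuclideanSpace ℝ (Fin n)), volume s ≠ ∞ →
      IntegrableOn (fun y => f y - f x) s := fun s hs =>
    hf.integrableOn.sub (integrableOn_const hs)
  have h1 : ∫ y in Q, |f y| ≤ t * (s / 2 ^ k) ^ n := by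
    have h2 : ∫ y in Q, ‖f y‖ = (∫⁻ y in Q, ‖f y‖ₑ).toReal :=
      integral_norm_eq_lintegral_enorm hf.1.restrict
    simp only [Real.norm_eq_abs] at h2
    rw [h2, ← hQv, measureReal_def, ← ENNReal.coe_toReal t, ← ENNReal.toReal_mul]
    exact ENNReal.toReal_mono (by finiteness) (hk k)
  have h3 : |f x| * (s / 2 ^ k) ^ n ≤ ∫ y in Q, (|f y - f x| + |f y|) := by
    rw [← hQv, mul_comm, ← smul_eq_mul, ← setIntegral_const]
    refine setIntegral_mono (integrableOn_const hQfin)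
      ((hconst Q hQfin).abs.add hf.integrableOn.abs) fun y => ?_
    have := abs_sub_abs_le_abs_sub (f x) (f y)
    rw [abs_sub_comm] at this
    simp only
    linarith
  have h4 : ∫ y in Q, (|f y - f x| + |f y|) = (∫ y in Q, |f y - f x|) + ∫ y in Q, |f y| :=
    integral_add (hconst Q hQfin).abs hf.integrableOn.abs
  have h5 : ∫ y in Q, |f y - f x| ≤ ∫ y in B, |f y - f x| :=
    setIntegral_mono_set (hconst B hBfin).abs (Eventually.of_forall fun y => abs_nonneg _)
      hQB.eventuallyLE
  have h6 : ∫ y in B, |f y - f x| = D * (s / 2 ^ k) ^ n * ⨍ y in B, ‖f y - f x‖ := by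
    have hBpos : volume.real B ≠ 0 := by
      refine (lt_of_lt_of_le (hQv ▸ hl) (measureReal_mono hQB hBfin)).ne'
    rw [setAverage_eq, ← hBv, smul_eq_mul, mul_inv_cancel_left₀ hBpos]
    rfl
  have h7 : |f x| * (s / 2 ^ k) ^ n ≤
      (t + D * ⨍ y in B, ‖f y - f x‖) * (s / 2 ^ k) ^ n := by
    calc _ ≤ _ := h3
      _ ≤ D * (s / 2 ^ k) ^ n * (⨍ y in B, ‖f y - f x‖) + t * (s / 2 ^ k) ^ n := by
        rw [h4, ← h6]
        exact add_le_add h5 h1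
      _ = _ := by ring
  exact le_of_mul_le_mul_right h7 hl

/-- The Calderón–Zygmund selection of disjoint cubes at height `t`. -/
theorem exists_calderonZygmund_cubes (hn : 1 ≤ n) : ∃ D : ℝ≥0,
    ∀ f : EuclideanSpace ℝ (Fin n) → ℝ, Integrable f → ∀ t : ℝ≥0, 0 < t →
    ∃ (ι : Type) (_ : Countable ι) (Q : ι → Set (EuclideanSpace ℝ (Fin n)))
      (c : ι → EuclideanSpace ℝ (Fin n)) (r : ι → ℝ),
      (∀ i, MeasurableSet (Q i)) ∧ Pairwise (Function.onFun Disjoint Q) ∧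
      (∀ i, Q i ⊆ closedBall (c i) (r i)) ∧ (∀ i, volume (Q i) ≠ 0) ∧ (∀ i, volume (Q i) ≠ ∞) ∧
      (∀ i, volume (ball (c i) (2 * r i)) ≤ D * volume (Q i)) ∧
      (∀ i, t * volume (Q i) ≤ ∫⁻ y in Q i, ‖f y‖ₑ) ∧
      (∀ i, ∫⁻ y in Q i, ‖f y‖ₑ ≤ 2 ^ n * t * volume (Q i)) ∧
      ∀ᵐ x, x ∉ ⋃ i, Q i → ‖f x‖ₑ ≤ t := by
  have : Nonempty (Fin n) := ⟨⟨0, hn⟩⟩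
  have hn0 : 0 < √(n : ℝ) := by positivity
  -- A ball of radius 2√n times the side of a cube has this multiple of the cube's volume.
  refine ⟨(ENNReal.ofReal ((2 * √n) ^ n) * volume (ball (0 : EuclideanSpace ℝ (Fin n)) 1)).toNNReal,
    fun f hf t ht => ?_⟩
  have hL : ∫⁻ y, ‖f y‖ₑ ≠ ∞ := hf.2.ne
  -- With s ≥ 1 and s ≥ ‖f‖₁/t, the initial cubes have volume s^n ≥ s ≥ ‖f‖₁/t, so none of them has
  -- average above t.
  set s : ℝ := max 1 ((∫⁻ y, ‖f y‖ₑ).toReal / t) with hs_def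
  have hs1 : 1 ≤ s := le_max_left _ _
  have hs : 0 < s := by linarith
  let q : ℕ → EuclideanSpace ℝ (Fin n) → Set (EuclideanSpace ℝ (Fin n)) :=
    fun k x => dyadicCube s k (dyadicIndex s k x)
  let bad : ℕ → EuclideanSpace ℝ (Fin n) → Prop :=
    fun k x => t * volume (q k x) < ∫⁻ y in q k x, ‖f y‖ₑ
  have hq : ∀ {j k x y}, j ≤ k → dyadicIndex s k x = dyadicIndex s k y → q j x = q j y := by
    intro j k x y hjk h
    simp only [q, dyadicIndex_eq_of_le hjk h]
  have hbad0 : ∀ x, ¬ bad 0 x := by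
    intro x
    simp only [bad, not_lt, q, volume_dyadicCube hs]
    refine (setLIntegral_le_lintegral _ _).trans ?_
    rw [← ENNReal.ofReal_toReal hL, ← ENNReal.ofReal_coe_nnreal,
      ← ENNReal.ofReal_mul t.coe_nonneg]
    refine ENNReal.ofReal_le_ofReal ?_
    calc (∫⁻ y, ‖f y‖ₑ).toReal = t * ((∫⁻ y, ‖f y‖ₑ).toReal / t) := by field_simp
      _ ≤ t * s := by gcongr; exact le_max_right _ _
      _ ≤ t * (s / 2 ^ 0) ^ n := by
        gcongr
        rw [pow_zero, div_one]
        exact le_self_pow₀ hs1 (by omega)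
  -- The selected cubes are the maximal bad ones: bad, with no bad ancestor. Each is later enclosed
  -- in a ball about any of its points.
  let S : Set (ℕ × (Fin n → ℤ)) :=
    {p | ∃ x, dyadicIndex s p.1 x = p.2 ∧ bad p.1 x ∧ ∀ j < p.1, ¬ bad j x}
  choose c hc hcb hcm using fun p : S => p.2
  have hQq : ∀ p : S, dyadicCube s p.1.1 p.1.2 = q p.1.1 (c p) := fun p => by
    simp only [q, hc]
  refine ⟨S, inferInstance, fun p => dyadicCube s p.1.1 p.1.2, c,
    fun p => √n * (s / 2 ^ p.1.1), fun p => measurableSet_dyadicCube hs _ _, ?_, ?_, ?_, ?_, ?_, ?_,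
    ?_, ?_⟩
  · intro p p' hpp'
    rw [Function.onFun, Set.disjoint_left]
    intro z hz hz'
    have hz1 : dyadicIndex s p.1.1 z = dyadicIndex s p.1.1 (c p) := hz.trans (hc p).symm
    have hz1' : dyadicIndex s p'.1.1 z = dyadicIndex s p'.1.1 (c p') := hz'.trans (hc p').symm
    have hb : ∀ j ≤ p.1.1, (bad j z ↔ bad j (c p)) := fun j hj => by
      simp only [bad, hq hj hz1]
    have hb' : ∀ j ≤ p'.1.1, (bad j z ↔ bad j (c p')) := fun j hj => by
      simp only [bad, hq hj hz1']
    have hk : p.1.1 = p'.1.1 := by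
      rcases lt_trichotomy p.1.1 p'.1.1 with h | h | h
      · exact absurd ((hb' _ h.le).1 ((hb _ le_rfl).2 (hcb p))) (hcm p' _ h)
      · exact h
      · exact absurd ((hb _ h.le).1 ((hb' _ le_rfl).2 (hcb p'))) (hcm p _ h)
    refine hpp' (Subtype.ext (Prod.ext hk ?_))
    have hz2 : dyadicIndex s p.1.1 z = p.1.2 := hz
    have hz2' : dyadicIndex s p'.1.1 z = p'.1.2 := hz'
    rw [← hz2, ← hz2', hk]
  · intro p z hz
    rw [mem_closedBall, dist_eq_norm]
    exact norm_sub_le_of_dyadicIndex_eq hs (hz.trans (hc p).symm)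
  · intro p
    rw [volume_dyadicCube hs]
    exact (ENNReal.ofReal_pos.2 (by positivity)).ne'
  · intro p
    rw [volume_dyadicCube hs]
    simp
  · intro p
    rw [volume_dyadicCube hs, Measure.addHaar_ball_of_pos _ _ (by positivity),
      finrank_euclideanSpace_fin, ENNReal.coe_toNNReal (by finiteness),
      ← mul_assoc, mul_pow, ENNReal.ofReal_mul (by positivity), mul_right_comm _ (volume _)]
  · intro p
    simp only [hQq]
    exact (hcb p).le
  · intro p
    simp only [hQq]
    -- Generation 0 is never bad, so a selected cube has a parent. The parent is not bad and has 2^n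
    -- times the volume, which gives the upper bound 2^n t for the average.
    obtain ⟨j, hj⟩ : ∃ j, p.1.1 = j + 1 := by
      refine Nat.exists_eq_succ_of_ne_zero fun h => hbad0 (c p) ?_
      rw [← h]
      exact hcb p
    have h1 : ¬ bad j (c p) := hcm p j (by omega)
    simp only [bad, not_lt] at h1
    have hsub : q p.1.1 (c p) ⊆ q j (c p) := fun y hy => dyadicIndex_eq_of_le (by omega) hy
    refine ((lintegral_mono_set hsub).trans h1).trans (le_of_eq ?_)
    simp only [q, volume_dyadicCube hs, hj]
    rw [mul_comm (2 ^ n), mul_assoc]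
    congr 1
    rw [show (2 : ℝ≥0∞) = ENNReal.ofReal 2 by simp, ← ENNReal.ofReal_pow zero_le_two,
      ← ENNReal.ofReal_mul (by positivity), ← mul_pow]
    congr 2
    rw [pow_succ]
    field_simp
  · filter_upwards [ae_enorm_le_of_forall_dyadicCube hn hf hs t] with x hx hxQ
    refine hx fun k => ?_
    by_contra hlt
    rw [not_le] at hlt
    classical
    -- If some cube containing x is bad, the one of least generation is selected, so x lies in the
    -- union.
    have hex : ∃ k, bad k x := ⟨k, hlt⟩
    exact hxQ (mem_iUnion.2 ⟨⟨(Nat.find hex, dyadicIndex s (Nat.find hex) x), x, rfl,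
      Nat.find_spec hex, fun j hj => Nat.find_min hex hj⟩, rfl⟩)

end DyadicCubes

/-! ### Calderón–Zygmund decomposition and weak type (1, 1). -/

section WeakType

variable {E : Type*} [NormedAddCommGroup E] [InnerProductSpace ℝ E] [FiniteDimensional ℝ E]
  [MeasurableSpace E] [BorelSpace E]

/-- The Hörmander condition with h = y - c after translating c to the origin: outside the doubled
ball, |x - c| ≥ 2r ≥ 2|y - c|. Taking s = 0 removes the truncation. -/
theorem IsCZKernel.lintegral_compl_ball_le {K : E → ℝ} {A : ℝ≥0} (hK : IsCZKernel K A) {c y : E}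
    {r : ℝ} (hy : y ∈ closedBall c r) :
    ∫⁻ x in (ball c (2 * r))ᶜ, ‖K (x - y) - K (x - c)‖ₑ ≤ A := by
  have h := hK.smooth 0 (y - c)
  simp only [norm_nonneg, ofPred_true, indicator_univ] at h
  have hm : MeasurableSet {z : E | 2 * ‖y - c‖ ≤ ‖z‖} :=
    measurableSet_le measurable_const measurable_norm
  rw [← lintegral_indicator hm] at h
  rw [← lintegral_indicator measurableSet_ball.compl, ← lintegral_add_right_eq_self _ c]
  refine (lintegral_mono fun z => ?_).trans h
  rw [mem_closedBall, dist_eq_norm] at hy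
  refine indicator_apply_le' (fun hz => ?_) (fun _ => zero_le)
  rw [mem_compl_iff, mem_ball, dist_eq_norm, add_sub_cancel_right, not_lt] at hz
  rw [indicator_of_mem (show z ∈ {z : E | 2 * ‖y - c‖ ≤ ‖z‖} from by
    rw [mem_ofPred_eq]; linarith)]
  rw [add_sub_cancel_right, show z + c - y = z - (y - c) by abel]

/-- Off the doubled balls, `K * b` is integrable if `b` has mean zero on each cell. -/
theorem IsCZKernel.lintegral_convOp_bad_le {K : E → ℝ} {A : ℝ≥0} (hK : IsCZKernel K A)
    {ι : Type*} [Countable ι] {Q : ι → Set E} {c : ι → E} {r : ι → ℝ}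
    (hQm : ∀ i, MeasurableSet (Q i)) (hQd : Pairwise (Function.onFun Disjoint Q))
    (hQc : ∀ i, Q i ⊆ closedBall (c i) (r i)) {b : E → ℝ} (hb : Integrable b)
    (hb0 : ∀ x ∉ ⋃ i, Q i, b x = 0) (hbQ : ∀ i, ∫ y in Q i, b y = 0) :
    ∫⁻ x in (⋃ i, ball (c i) (2 * r i))ᶜ, ‖convOp K b x‖ₑ ≤ A * ∫⁻ y, ‖b y‖ₑ := by
  obtain ⟨M, hM⟩ := hK.exists_bound
  have hKm := hK.measurable
  have hprod : ∀ x, Integrable fun y => K (x - y) * b y := fun x =>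
    hb.bdd_mul (c := M) (hKm.comp (measurable_const.sub measurable_id)).aestronglyMeasurable
      (Eventually.of_forall fun y => hM _)
  have hpt : ∀ x, ‖convOp K b x‖ₑ ≤
      ∑' i, ∫⁻ y in Q i, ‖K (x - y) - K (x - c i)‖ₑ * ‖b y‖ₑ := by
    intro x
    have h1 : convOp K b x = ∫ y in ⋃ i, Q i, K (x - y) * b y := by
      rw [convOp, setIntegral_eq_integral_of_forall_compl_eq_zero]
      intro y hy
      rw [hb0 y hy, mul_zero]
    have h2 := hasSum_integral_iUnion hQm hQd (hprod x).integrableOn (μ := volume)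
    rw [h1, ← h2.tsum_eq]
    refine (enorm_tsum_le_tsum_enorm).trans (ENNReal.tsum_le_tsum fun i => ?_)
    -- K(x - c i) is constant in y, so the mean zero of b on the cell allows it to be subtracted.
    have h3 : ∫ y in Q i, K (x - y) * b y = ∫ y in Q i, (K (x - y) - K (x - c i)) * b y := by
      simp only [sub_mul]
      rw [integral_sub (hprod x).integrableOn (hb.const_mul _).integrableOn, integral_const_mul,
        hbQ, mul_zero, sub_zero]
    rw [h3]
    refine (enorm_integral_le_lintegral_enorm _).trans_eq ?_
    simp only [enorm_mul]
  have hmeas : ∀ i, Measurable fun p : E × E => ‖K (p.1 - p.2) - K (p.1 - c i)‖ₑ := fun i => by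
    fun_prop
  have hae : ∀ i (s : Set E), AEMeasurable
      (fun p : E × E => ‖K (p.1 - p.2) - K (p.1 - c i)‖ₑ * ‖b p.2‖ₑ)
      ((volume.restrict s).prod (volume.restrict (Q i))) := fun i s =>
    (hmeas i).aemeasurable.mul (hb.1.enorm.restrict.comp_snd)
  calc ∫⁻ x in (⋃ i, ball (c i) (2 * r i))ᶜ, ‖convOp K b x‖ₑ
      ≤ ∫⁻ x in (⋃ i, ball (c i) (2 * r i))ᶜ,
          ∑' i, ∫⁻ y in Q i, ‖K (x - y) - K (x - c i)‖ₑ * ‖b y‖ₑ := lintegral_mono hpt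
    _ = ∑' i, ∫⁻ x in (⋃ i, ball (c i) (2 * r i))ᶜ,
          ∫⁻ y in Q i, ‖K (x - y) - K (x - c i)‖ₑ * ‖b y‖ₑ :=
        lintegral_tsum fun i => (hae i _).lintegral_prod_right'
    _ ≤ ∑' i, ∫⁻ x in (ball (c i) (2 * r i))ᶜ,
          ∫⁻ y in Q i, ‖K (x - y) - K (x - c i)‖ₑ * ‖b y‖ₑ :=
        ENNReal.tsum_le_tsum fun i => lintegral_mono_set
          (compl_subset_compl.2 (subset_iUnion (fun i => ball (c i) (2 * r i)) i))
    _ = ∑' i, ∫⁻ y in Q i, (∫⁻ x in (ball (c i) (2 * r i))ᶜ, ‖K (x - y) - K (x - c i)‖ₑ) *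
          ‖b y‖ₑ := by
        congr 1 with i
        rw [lintegral_lintegral_swap (hae i _)]
        refine lintegral_congr fun y => ?_
        rw [lintegral_mul_const]
        exact (hmeas i).comp (measurable_id.prodMk measurable_const)
    _ ≤ ∑' i, ∫⁻ y in Q i, A * ‖b y‖ₑ := by
        refine ENNReal.tsum_le_tsum fun i => setLIntegral_mono' (hQm i) fun y hy => ?_
        gcongr
        exact hK.lintegral_compl_ball_le (hQc i hy)
    _ = ∫⁻ y in ⋃ i, Q i, A * ‖b y‖ₑ := (lintegral_iUnion hQm hQd _).symm
    _ ≤ ∫⁻ y, A * ‖b y‖ₑ := setLIntegral_le_lintegral _ _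
    _ = A * ∫⁻ y, ‖b y‖ₑ := lintegral_const_mul'' _ hb.1.enorm

/-- Averaging an integrable function over countably many disjoint cells. -/
theorem exists_averaged {α : Type*} [MeasurableSpace α] {μ : Measure α}
    {ι : Type*} [Countable ι] {Q : ι → Set α}
    (hQm : ∀ i, MeasurableSet (Q i)) (hQd : Pairwise (Function.onFun Disjoint Q))
    (hQ0 : ∀ i, μ (Q i) ≠ 0) (hQfin : ∀ i, μ (Q i) ≠ ∞)
    {f : α → ℝ} (hf : Integrable f μ) {t : ℝ≥0∞}
    (hft : ∀ i, ∫⁻ y in Q i, ‖f y‖ₑ ∂μ ≤ t * μ (Q i))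
    (hfc : ∀ᵐ x ∂μ, x ∉ ⋃ i, Q i → ‖f x‖ₑ ≤ t) :
    ∃ g : α → ℝ, Integrable g μ ∧ (∀ᵐ x ∂μ, ‖g x‖ₑ ≤ t) ∧
      ∫⁻ x, ‖g x‖ₑ ∂μ ≤ ∫⁻ x, ‖f x‖ₑ ∂μ ∧ (∀ x ∉ ⋃ i, Q i, g x = f x) ∧
      ∀ i, ∫ x in Q i, g x ∂μ = ∫ x in Q i, f x ∂μ := by
  classical
  let a : ι → ℝ := fun i => ⨍ x in Q i, f x ∂μ
  let g : α → ℝ := fun x => if h : ∃ i, x ∈ Q i then a h.choose else f x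
  have hgQ : ∀ i, ∀ x ∈ Q i, g x = a i := by
    intro i x hx
    have h : ∃ i, x ∈ Q i := ⟨i, hx⟩
    have : h.choose = i := by
      by_contra hne
      exact Set.disjoint_left.1 (hQd hne) h.choose_spec hx
    simp only [g, dif_pos h, this]
  have hgc : ∀ x ∉ ⋃ i, Q i, g x = f x := by
    intro x hx
    rw [mem_iUnion] at hx
    simp only [g, dif_neg hx]
  -- Averaging does not increase the L¹ norm on a cell; this yields both the L¹ bound and, with the
  -- hypothesis on cell averages, the pointwise bound on g.
  have ha : ∀ i, ‖a i‖ₑ * μ (Q i) ≤ ∫⁻ x in Q i, ‖f x‖ₑ ∂μ := by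
    intro i
    have h1 : ‖a i‖ₑ * μ (Q i) = ‖∫ x in Q i, f x ∂μ‖ₑ := by
      have h2 : μ.real (Q i) ≠ 0 := by
        rw [measureReal_def]; exact ENNReal.toReal_ne_zero.2 ⟨hQ0 i, hQfin i⟩
      have h3 : μ (Q i) = ‖μ.real (Q i)‖ₑ := by
        rw [Real.enorm_of_nonneg measureReal_nonneg, measureReal_def,
          ENNReal.ofReal_toReal (hQfin i)]
      rw [h3, ← enorm_mul]
      simp only [a, setAverage_eq, smul_eq_mul]
      rw [mul_comm, mul_inv_cancel_left₀ h2]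
    rw [h1]
    exact enorm_integral_le_lintegral_enorm _
  have hU : MeasurableSet (⋃ i, Q i) := MeasurableSet.iUnion hQm
  have hle : ∫⁻ x, ‖g x‖ₑ ∂μ ≤ ∫⁻ x, ‖f x‖ₑ ∂μ := by
    rw [← lintegral_add_compl _ hU, ← lintegral_add_compl (fun x => ‖f x‖ₑ) hU]
    gcongr ?_ + ?_
    · rw [lintegral_iUnion hQm hQd, lintegral_iUnion hQm hQd]
      refine ENNReal.tsum_le_tsum fun i => le_trans (le_of_eq ?_) (ha i)
      rw [setLIntegral_congr_fun (hQm i) fun x hx => by rw [hgQ i x hx], setLIntegral_const]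
    · exact le_of_eq (setLIntegral_congr_fun hU.compl fun x hx => by rw [hgc x hx])
  have hgm : AEStronglyMeasurable g μ := by
    rw [aestronglyMeasurable_iff_aemeasurable, ← Measure.restrict_univ (μ := μ),
      ← union_compl_self (⋃ i, Q i), aemeasurable_union_iff]
    constructor
    · rw [aemeasurable_iUnion_iff]
      intro i
      refine (aemeasurable_const (b := a i)).congr ?_
      filter_upwards [ae_restrict_mem (hQm i)] with x hx
      rw [hgQ i x hx]
    · refine hf.aemeasurable.restrict.congr ?_
      filter_upwards [ae_restrict_mem hU.compl] with x hx
      rw [hgc x hx]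
  refine ⟨g, ⟨hgm, hle.trans_lt hf.2⟩, ?_, hle, hgc, fun i => ?_⟩
  · filter_upwards [hfc] with x hx
    by_cases hxQ : x ∈ ⋃ i, Q i
    · obtain ⟨i, hi⟩ := mem_iUnion.1 hxQ
      rw [hgQ i x hi]
      exact (ENNReal.mul_le_mul_iff_left (hQ0 i) (hQfin i)).1 ((ha i).trans (hft i))
    · rw [hgc x hxQ]
      exact hx hxQ
  · rw [setIntegral_congr_fun (hQm i) (hgQ i), setIntegral_const]
    have h2 : μ.real (Q i) ≠ 0 := by
      rw [measureReal_def]; exact ENNReal.toReal_ne_zero.2 ⟨hQ0 i, hQfin i⟩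
    simp only [a, setAverage_eq, smul_eq_mul]
    rw [mul_inv_cancel_left₀ h2]

theorem lintegral_enorm_sq_le {α : Type*} [MeasurableSpace α] {μ : Measure α} {g : α → ℝ}
    (hg : Integrable g μ) {t : ℝ≥0∞} (ht : ∀ᵐ x ∂μ, ‖g x‖ₑ ≤ t) :
    ∫⁻ x, ‖g x‖ₑ ^ (2 : ℝ) ∂μ ≤ t * ∫⁻ x, ‖g x‖ₑ ∂μ := by
  rw [← lintegral_const_mul'' _ hg.1.enorm]
  refine lintegral_mono_ae ?_
  filter_upwards [ht] with x hx
  rw [ENNReal.rpow_two, sq]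
  gcongr

theorem eLpNorm_two_sq {α : Type*} [MeasurableSpace α] {μ : Measure α} (g : α → ℝ) :
    eLpNorm g 2 μ ^ (2 : ℝ) = ∫⁻ x, ‖g x‖ₑ ^ (2 : ℝ) ∂μ := by
  simpa using eLpNorm_nnreal_pow_eq_lintegral (f := g) (p := 2) (μ := μ) (by simp)

theorem mul_meas_lt_enorm_le {α : Type*} [MeasurableSpace α] {μ : Measure α} {F : α → ℝ}
    (hF : AEStronglyMeasurable F μ) {p : ℝ} (hp : 0 < p) (t : ℝ≥0∞) :
    t ^ p * μ {x | t < ‖F x‖ₑ} ≤ ∫⁻ x, ‖F x‖ₑ ^ p ∂μ := by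
  refine le_trans ?_ (mul_meas_ge_le_lintegral₀ (hF.enorm.pow_const p) (t ^ p))
  gcongr with x
  intro hx
  exact ENNReal.rpow_le_rpow (le_of_lt hx) hp.le

/-- Calderón–Zygmund kernels are of weak type `(1, 1)`. -/
theorem IsCZKernel.exists_weakType {n : ℕ} (hn : 1 ≤ n) (A : ℝ≥0) : ∃ C : ℝ≥0,
    ∀ K : EuclideanSpace ℝ (Fin n) → ℝ, IsCZKernel K A →
    ∀ f : EuclideanSpace ℝ (Fin n) → ℝ, Integrable f → ∀ t : ℝ≥0, 0 < t →
      t * volume {x | t < ‖convOp K f x‖ₑ} ≤ C * ∫⁻ x, ‖f x‖ₑ := by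
  have : Nonempty (Fin n) := ⟨⟨0, hn⟩⟩
  obtain ⟨D, hD⟩ := exists_calderonZygmund_cubes hn
  obtain ⟨C₂, hC₂⟩ := IsCZKernel.exists_eLpNorm_two_le (E := EuclideanSpace ℝ (Fin n)) A
  -- The three summands pay for the good part in L², for the doubled balls, and for the bad part
  -- outside them.
  refine ⟨4 * C₂ ^ 2 * 2 ^ n + D + 4 * A, fun K hK f hf t ht => ?_⟩
  obtain ⟨ι, _, Q, c, r, hQm, hQd, hQc, hQ0, hQfin, hball, hlow, hup, hae⟩ := hD f hf t ht
  have h2n : (t : ℝ≥0∞) ≤ 2 ^ n * t := le_mul_of_one_le_left zero_le (one_le_pow₀ one_le_two)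
  obtain ⟨g, hg, hgt, hgf, hgc, hgQ⟩ := exists_averaged hQm hQd hQ0 hQfin hf hup
    (by filter_upwards [hae] with x hx h using (hx h).trans h2n)
  obtain ⟨M, hM⟩ := hK.exists_bound
  set L := ∫⁻ x, ‖f x‖ₑ with hL
  have hKs := hK.measurable.aestronglyMeasurable (μ := (volume : Measure (EuclideanSpace ℝ (Fin n))))
  have ht0 : (t : ℝ≥0∞) ≠ 0 := by simpa using ht.ne'
  -- the good part
  have hg2 : ∫⁻ x, ‖g x‖ₑ ^ (2 : ℝ) ≤ 2 ^ n * t * L :=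
    (lintegral_enorm_sq_le hg hgt).trans (by gcongr)
  have hgm : MemLp g 2 := by
    refine ⟨hg.1, ?_⟩
    have h1 : eLpNorm g 2 volume ^ (2 : ℝ) < ∞ := by
      rw [eLpNorm_two_sq]
      refine hg2.trans_lt ?_
      have : L ≠ ∞ := hf.2.ne
      finiteness
    exact (ENNReal.rpow_lt_top_iff_of_pos two_pos).1 h1
  have hgood : t * volume {x | (t : ℝ≥0∞) / 2 < ‖convOp K g x‖ₑ} ≤ 4 * C₂ ^ 2 * 2 ^ n * L := by
    have h1 := mul_meas_lt_enorm_le (aestronglyMeasurable_convOp hKs hg.1) two_pos ((t : ℝ≥0∞) / 2)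
    have h2 : ∫⁻ x, ‖convOp K g x‖ₑ ^ (2 : ℝ) ≤ C₂ ^ 2 * (2 ^ n * t * L) := by
      rw [← eLpNorm_two_sq]
      calc eLpNorm (convOp K g) 2 volume ^ (2 : ℝ) ≤ (C₂ * eLpNorm g 2) ^ (2 : ℝ) := by
            gcongr
            exact hC₂ K hK g hg hgm
        _ = C₂ ^ 2 * ∫⁻ x, ‖g x‖ₑ ^ (2 : ℝ) := by
            rw [ENNReal.mul_rpow_of_nonneg _ _ zero_le_two, eLpNorm_two_sq, ENNReal.rpow_two]
        _ ≤ _ := by gcongr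
    have h3 := h1.trans h2
    generalize volume {x | (t : ℝ≥0∞) / 2 < ‖convOp K g x‖ₑ} = V at *
    have h4 : (t : ℝ≥0∞) * (t * V) = 4 * (((t : ℝ≥0∞) / 2) ^ (2 : ℝ) * V) := by
      have h5 : (t : ℝ≥0∞) = 2 * (t / 2) := by
        rw [ENNReal.mul_div_cancel two_ne_zero ENNReal.ofNat_ne_top]
      rw [ENNReal.rpow_two]
      nth_rewrite 1 2 [h5]
      ring
    -- Chebyshev bounds (t/2)² V, while ‖g‖₂² ≤ 2^n t L carries only one factor t; multiplying by t
    -- and cancelling leaves the linear estimate.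
    rw [← ENNReal.mul_le_mul_iff_right ht0 ENNReal.coe_ne_top, h4]
    calc _ ≤ 4 * (C₂ ^ 2 * (2 ^ n * t * L)) := by gcongr
      _ = _ := by ring
  -- the bad part
  set b := f - g with hb
  have hbi : Integrable b := hf.sub hg
  have hbL : ∫⁻ x, ‖b x‖ₑ ≤ 2 * L := by
    calc ∫⁻ x, ‖b x‖ₑ ≤ ∫⁻ x, (‖f x‖ₑ + ‖g x‖ₑ) := lintegral_mono fun x => enorm_sub_le
      _ = L + ∫⁻ x, ‖g x‖ₑ := lintegral_add_left' hf.1.enorm _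
      _ ≤ L + L := by gcongr
      _ = 2 * L := (two_mul L).symm
  set U := ⋃ i, ball (c i) (2 * r i) with hU
  have hUm : MeasurableSet U := MeasurableSet.iUnion fun i => measurableSet_ball
  have hbad := hK.lintegral_convOp_bad_le hQm hQd hQc hbi
    (fun x hx => by simp [hb, hgc x hx])
    (fun i => by
      simp only [hb, Pi.sub_apply]
      rw [integral_sub hf.integrableOn hg.integrableOn, hgQ, sub_self])
  have hbad2 : t * volume ({x | (t : ℝ≥0∞) / 2 < ‖convOp K b x‖ₑ} ∩ Uᶜ) ≤ 4 * A * L := by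
    have h1 := mul_meas_lt_enorm_le (μ := volume.restrict Uᶜ)
      (aestronglyMeasurable_convOp hKs hbi.1).restrict one_pos ((t : ℝ≥0∞) / 2)
    simp only [ENNReal.rpow_one] at h1
    rw [Measure.restrict_apply' hUm.compl] at h1
    have h3 := (h1.trans hbad).trans (by gcongr : A * ∫⁻ x, ‖b x‖ₑ ≤ A * (2 * L))
    generalize volume ({x | (t : ℝ≥0∞) / 2 < ‖convOp K b x‖ₑ} ∩ Uᶜ) = V at *
    calc (t : ℝ≥0∞) * V = 2 * (t / 2 * V) := by
          rw [← mul_assoc, ENNReal.mul_div_cancel two_ne_zero ENNReal.ofNat_ne_top]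
      _ ≤ 2 * (A * (2 * L)) := by gcongr
      _ = _ := by ring
  -- Each selected cube carries L¹ mass at least t times its volume, and the cubes are disjoint.
  have hUv : t * volume U ≤ D * L := by
    calc t * volume U ≤ t * ∑' i, volume (ball (c i) (2 * r i)) := by
          gcongr
          exact measure_iUnion_le _
      _ ≤ t * ∑' i, D * volume (Q i) := by
          gcongr with i
          exact hball i
      _ = D * ∑' i, t * volume (Q i) := by
          rw [ENNReal.tsum_mul_left, ENNReal.tsum_mul_left]
          ring
      _ ≤ D * ∑' i, ∫⁻ y in Q i, ‖f y‖ₑ := by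
          gcongr with i
          exact hlow i
      _ = D * ∫⁻ y in ⋃ i, Q i, ‖f y‖ₑ := by rw [lintegral_iUnion hQm hQd]
      _ ≤ D * L := by
          gcongr
          exact setLIntegral_le_lintegral _ _
  have hsub : {x | (t : ℝ≥0∞) < ‖convOp K f x‖ₑ} ⊆ {x | (t : ℝ≥0∞) / 2 < ‖convOp K g x‖ₑ} ∪ U ∪
      ({x | (t : ℝ≥0∞) / 2 < ‖convOp K b x‖ₑ} ∩ Uᶜ) := by
    intro x hx
    by_contra hcon
    simp only [mem_union, mem_inter_iff, mem_ofPred_eq, not_or, not_and, mem_compl_iff, not_lt,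
      not_not] at hcon hx
    obtain ⟨⟨h1, h2⟩, h3⟩ := hcon
    have h4 : ‖convOp K b x‖ₑ ≤ t / 2 := by
      by_contra h
      exact h2 (h3 (not_le.1 h))
    have h5 : convOp K f x = convOp K g x + convOp K b x := by
      rw [hb, convOp_sub hKs hM hf hg]
      ring
    rw [h5] at hx
    refine absurd hx (not_lt.2 ((enorm_add_le _ _).trans ?_))
    calc _ ≤ (t : ℝ≥0∞) / 2 + t / 2 := add_le_add h1 h4
      _ = t := ENNReal.add_halves _
  calc t * volume {x | (t : ℝ≥0∞) < ‖convOp K f x‖ₑ}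
      ≤ t * (volume {x | (t : ℝ≥0∞) / 2 < ‖convOp K g x‖ₑ} + volume U +
        volume ({x | (t : ℝ≥0∞) / 2 < ‖convOp K b x‖ₑ} ∩ Uᶜ)) := by
        gcongr
        exact (measure_mono hsub).trans ((measure_union_le _ _).trans
          (by gcongr; exact measure_union_le _ _))
    _ ≤ 4 * C₂ ^ 2 * 2 ^ n * L + D * L + 4 * A * L := by
        rw [mul_add, mul_add]
        gcongr
    _ = _ := by push_cast; ring

end WeakType

/-! ### Marcinkiewicz interpolation between (1, 1) and (2, 2). -/

section Interpolation

theorem setLIntegral_Ioo_rpow {p u : ℝ} (hp : -1 < p) (hu : 0 ≤ u) :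
    ∫⁻ t in Ioo 0 u, ENNReal.ofReal (t ^ p) = ENNReal.ofReal (u ^ (p + 1) / (p + 1)) := by
  have h := (intervalIntegral.intervalIntegrable_rpow' hp (a := 0) (b := u)).1
  rw [Measure.restrict_congr_set Ioo_ae_eq_Ioc, ← ofReal_integral_eq_lintegral_ofReal h,
    ← intervalIntegral.integral_of_le hu, integral_rpow (Or.inl hp), Real.zero_rpow (by linarith),
    sub_zero]
  filter_upwards [ae_restrict_mem measurableSet_Ioc] with t ht
  exact Real.rpow_nonneg ht.1.le _

theorem setLIntegral_Ioi_rpow {p u : ℝ} (hp : p < -1) (hu : 0 < u) :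
    ∫⁻ t in Ioi u, ENNReal.ofReal (t ^ p) = ENNReal.ofReal (-u ^ (p + 1) / (p + 1)) := by
  rw [← ofReal_integral_eq_lintegral_ofReal (integrableOn_Ioi_rpow_of_lt hp hu),
    integral_Ioi_rpow_of_lt hp hu]
  filter_upwards [ae_restrict_mem measurableSet_Ioi] with t ht
  exact Real.rpow_nonneg (hu.trans ht).le _

variable {α : Type*} [MeasurableSpace α] {μ : Measure α} [SFinite μ]

/-- Tonelli: for fixed x the t-integral runs over 0 < t < |f x| and equals |f x|^(p-1)/(p-1),
convergent at 0 because p > 1. It sums the weak (1,1) contributions of the large part of f. -/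
theorem lintegral_Ioi_tail_eq {f : α → ℝ} (hf : Measurable f) {p : ℝ} (hp : 1 < p) :
    ∫⁻ t in Ioi (0 : ℝ), ENNReal.ofReal (t ^ (p - 2)) *
      ∫⁻ x, {x | t < |f x|}.indicator (fun x => ‖f x‖ₑ) x ∂μ =
      ENNReal.ofReal (p - 1)⁻¹ * ∫⁻ x, ‖f x‖ₑ ^ p ∂μ := by
  have hS : MeasurableSet {z : ℝ × α | z.1 < |f z.2|} :=
    measurableSet_lt measurable_fst (by fun_prop)
  have hm : Measurable fun z : ℝ × α => ENNReal.ofReal (z.1 ^ (p - 2)) *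
      {z : ℝ × α | z.1 < |f z.2|}.indicator (fun z => ‖f z.2‖ₑ) z :=
    Measurable.mul (by fun_prop) (Measurable.indicator (by fun_prop) hS)
  have hm1 : ∀ t : ℝ, Measurable ({x | t < |f x|}.indicator fun x => ‖f x‖ₑ) := fun t =>
    Measurable.indicator (by fun_prop) (measurableSet_lt measurable_const (by fun_prop))
  calc _ = ∫⁻ t in Ioi (0 : ℝ), ∫⁻ x, ENNReal.ofReal (t ^ (p - 2)) *
      {x | t < |f x|}.indicator (fun x => ‖f x‖ₑ) x ∂μ := by
        refine lintegral_congr fun t => ?_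
        rw [lintegral_const_mul _ (hm1 t)]
    _ = ∫⁻ x, (∫⁻ t in Ioi (0 : ℝ), ENNReal.ofReal (t ^ (p - 2)) *
      {x | t < |f x|}.indicator (fun x => ‖f x‖ₑ) x) ∂μ :=
        lintegral_lintegral_swap hm.aemeasurable
    _ = ∫⁻ x, ENNReal.ofReal (p - 1)⁻¹ * ‖f x‖ₑ ^ p ∂μ := by
        refine lintegral_congr fun x => ?_
        have h1 : ∀ t, ENNReal.ofReal (t ^ (p - 2)) *
            {x | t < |f x|}.indicator (fun x => ‖f x‖ₑ) x =
            (Iio |f x|).indicator (fun t => ENNReal.ofReal (t ^ (p - 2)) * ‖f x‖ₑ) t := by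
          intro t
          by_cases h : t < |f x|
          · rw [indicator_of_mem (show x ∈ {x | t < |f x|} from h), indicator_of_mem (mem_Iio.2 h)]
          · rw [indicator_of_notMem (show x ∉ {x | t < |f x|} from h),
              indicator_of_notMem (by simpa using h), mul_zero]
        simp only [h1]
        rw [lintegral_indicator measurableSet_Iio, Measure.restrict_restrict measurableSet_Iio,
          inter_comm, Ioi_inter_Iio, lintegral_mul_const _ (by fun_prop),
          setLIntegral_Ioo_rpow (by linarith) (abs_nonneg _), Real.enorm_eq_ofReal_abs,
          ENNReal.ofReal_rpow_of_nonneg (abs_nonneg _) (by linarith),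
          ← ENNReal.ofReal_mul (by
            have : 0 < p - 2 + 1 := by linarith
            positivity), ← ENNReal.ofReal_mul (by rw [inv_nonneg]; linarith)]
        congr 1
        rw [show p - 2 + 1 = p - 1 by ring, div_mul_eq_mul_div, inv_mul_eq_div]
        congr 1
        nth_rewrite 2 [← Real.rpow_one |f x|]
        rw [← Real.rpow_add_of_nonneg (abs_nonneg _) (by linarith) zero_le_one]
        congr 1; ring
    _ = _ := lintegral_const_mul _ (by fun_prop)

/-- Tonelli again: the t-integral over t ≥ |f x| equals |f x|^(p-2)/(2-p), convergent at infinity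
because p < 2. It sums the L² contributions of the small part of f. -/
theorem lintegral_Ioi_head_eq {f : α → ℝ} (hf : Measurable f) {p : ℝ} (hp0 : 0 < p) (hp : p < 2) :
    ∫⁻ t in Ioi (0 : ℝ), ENNReal.ofReal (t ^ (p - 3)) *
      ∫⁻ x, {x | |f x| ≤ t}.indicator (fun x => ‖f x‖ₑ ^ (2 : ℝ)) x ∂μ =
      ENNReal.ofReal (2 - p)⁻¹ * ∫⁻ x, ‖f x‖ₑ ^ p ∂μ := by
  have hS : MeasurableSet {z : ℝ × α | |f z.2| ≤ z.1} :=
    measurableSet_le (by fun_prop) measurable_fst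
  have hm : Measurable fun z : ℝ × α => ENNReal.ofReal (z.1 ^ (p - 3)) *
      {z : ℝ × α | |f z.2| ≤ z.1}.indicator (fun z => ‖f z.2‖ₑ ^ (2 : ℝ)) z :=
    Measurable.mul (by fun_prop) (Measurable.indicator (by fun_prop) hS)
  have hm1 : ∀ t : ℝ, Measurable ({x | |f x| ≤ t}.indicator fun x => ‖f x‖ₑ ^ (2 : ℝ)) := fun t =>
    Measurable.indicator (by fun_prop) (measurableSet_le (by fun_prop) measurable_const)
  calc _ = ∫⁻ t in Ioi (0 : ℝ), ∫⁻ x, ENNReal.ofReal (t ^ (p - 3)) *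
      {x | |f x| ≤ t}.indicator (fun x => ‖f x‖ₑ ^ (2 : ℝ)) x ∂μ := by
        refine lintegral_congr fun t => ?_
        rw [lintegral_const_mul _ (hm1 t)]
    _ = ∫⁻ x, (∫⁻ t in Ioi (0 : ℝ), ENNReal.ofReal (t ^ (p - 3)) *
      {x | |f x| ≤ t}.indicator (fun x => ‖f x‖ₑ ^ (2 : ℝ)) x) ∂μ :=
        lintegral_lintegral_swap hm.aemeasurable
    _ = ∫⁻ x, ENNReal.ofReal (2 - p)⁻¹ * ‖f x‖ₑ ^ p ∂μ := by
        refine lintegral_congr fun x => ?_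
        by_cases hfx : f x = 0
        · simp [hfx, indicator, hp0]
        have hu : 0 < |f x| := abs_pos.2 hfx
        have h1 : ∀ t, ENNReal.ofReal (t ^ (p - 3)) *
            {x | |f x| ≤ t}.indicator (fun x => ‖f x‖ₑ ^ (2 : ℝ)) x =
            (Ici |f x|).indicator (fun t => ENNReal.ofReal (t ^ (p - 3)) * ‖f x‖ₑ ^ (2 : ℝ)) t := by
          intro t
          by_cases h : |f x| ≤ t
          · rw [indicator_of_mem (show x ∈ {x | |f x| ≤ t} from h), indicator_of_mem (mem_Ici.2 h)]
          · rw [indicator_of_notMem (show x ∉ {x | |f x| ≤ t} from h),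
              indicator_of_notMem (by simpa using h), mul_zero]
        simp only [h1]
        have hI : Ici |f x| ∩ Ioi 0 = Ici |f x| :=
          inter_eq_left.2 fun t ht => hu.trans_le ht
        rw [lintegral_indicator measurableSet_Ici, Measure.restrict_restrict measurableSet_Ici, hI,
          lintegral_mul_const _ (by fun_prop), Measure.restrict_congr_set Ioi_ae_eq_Ici.symm,
          setLIntegral_Ioi_rpow (by linarith) hu, Real.enorm_eq_ofReal_abs,
          ENNReal.ofReal_rpow_of_nonneg (abs_nonneg _) (by linarith),
          ENNReal.ofReal_rpow_of_nonneg (abs_nonneg _) (by linarith),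
          ← ENNReal.ofReal_mul (by
            rw [neg_div, ← div_neg]
            have : 0 < -(p - 3 + 1) := by linarith
            positivity), ← ENNReal.ofReal_mul (by rw [inv_nonneg]; linarith)]
        congr 1
        rw [show p - 3 + 1 = -(2 - p) by ring, neg_div_neg_eq, div_mul_eq_mul_div, inv_mul_eq_div,
          ← Real.rpow_add hu]
        congr 2; ring
    _ = _ := lintegral_const_mul _ (by fun_prop)

/-- Marcinkiewicz interpolation between weak type `(1, 1)` and strong type `(2, 2)`. -/
theorem lintegral_rpow_le_of_weakType {T : (α → ℝ) → α → ℝ}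
    (hTm : ∀ f, Integrable f μ → AEStronglyMeasurable (T f) μ)
    (hT : ∀ f g, Integrable f μ → Integrable g μ → ∀ x, T (f + g) x = T f x + T g x)
    {C₁ C₂ : ℝ≥0}
    (h1 : ∀ f, Integrable f μ → ∀ t : ℝ≥0, 0 < t →
      t * μ {x | t < ‖T f x‖ₑ} ≤ C₁ * ∫⁻ x, ‖f x‖ₑ ∂μ)
    (h2 : ∀ f, Integrable f μ → MemLp f 2 μ → eLpNorm (T f) 2 μ ≤ C₂ * eLpNorm f 2 μ)
    {p : ℝ} (hp1 : 1 < p) (hp2 : p < 2) {f : α → ℝ} (hfm : Measurable f) (hf : Integrable f μ) :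
    ∫⁻ x, ‖T f x‖ₑ ^ p ∂μ ≤ 2 ^ p * (ENNReal.ofReal p * (C₁ * ENNReal.ofReal (p - 1)⁻¹ +
      C₂ ^ 2 * ENNReal.ofReal (2 - p)⁻¹)) * ∫⁻ x, ‖f x‖ₑ ^ p ∂μ := by
  have hp0 : 0 < p := by linarith
  -- At each level t the function is cut at height t: where |T f| > 2t, one of the two pieces has
  -- |T| > t. The piece above t is treated by weak type, the bounded piece by Chebyshev in L².
  have hset : ∀ t : ℝ, 0 < t → μ {x | t < |T f x| / 2} * ENNReal.ofReal (t ^ (p - 1)) ≤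
      C₁ * (ENNReal.ofReal (t ^ (p - 2)) *
        ∫⁻ x, {x | t < |f x|}.indicator (fun x => ‖f x‖ₑ) x ∂μ) +
      C₂ ^ 2 * (ENNReal.ofReal (t ^ (p - 3)) *
        ∫⁻ x, {x | |f x| ≤ t}.indicator (fun x => ‖f x‖ₑ ^ (2 : ℝ)) x ∂μ) := by
    intro t ht
    set S := {x | t < |f x|} with hS
    have hSm : MeasurableSet S := measurableSet_lt measurable_const (by fun_prop)
    have hSc : {x | |f x| ≤ t} = Sᶜ := by ext; simp [hS]
    set f₁ := S.indicator f
    set f₂ := Sᶜ.indicator f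
    have hf₁ : Integrable f₁ μ := hf.indicator hSm
    have hf₂ : Integrable f₂ μ := hf.indicator hSm.compl
    have hadd : f = f₁ + f₂ := (indicator_self_add_compl S f).symm
    have hT' : (t.toNNReal : ℝ≥0∞) = ENNReal.ofReal t := rfl
    have ht0 : ENNReal.ofReal t ≠ 0 := by simpa using ht
    have hbound : ∀ᵐ x ∂μ, ‖f₂ x‖ₑ ≤ ENNReal.ofReal t := by
      refine Eventually.of_forall fun x => ?_
      by_cases hx : x ∈ Sᶜ
      · simp only [f₂, indicator_of_mem hx]
        rw [Real.enorm_eq_ofReal_abs]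
        refine ENNReal.ofReal_le_ofReal ?_
        rw [← hSc] at hx
        exact hx
      · simp [f₂, indicator_of_notMem hx]
    have hsq := lintegral_enorm_sq_le hf₂ hbound
    have hf₂' : MemLp f₂ 2 μ := by
      refine ⟨hf₂.1, (ENNReal.rpow_lt_top_iff_of_pos two_pos).1 ?_⟩
      rw [eLpNorm_two_sq]
      exact hsq.trans_lt (ENNReal.mul_lt_top (by simp) hf₂.2)
    have hw := h1 f₁ hf₁ t.toNNReal (by simpa using ht)
    rw [hT'] at hw
    have hs := mul_meas_lt_enorm_le (hTm f₂ hf₂) two_pos (ENNReal.ofReal t)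
    have hs2 : ∫⁻ x, ‖T f₂ x‖ₑ ^ (2 : ℝ) ∂μ ≤ C₂ ^ 2 * ∫⁻ x, ‖f₂ x‖ₑ ^ (2 : ℝ) ∂μ := by
      rw [← eLpNorm_two_sq, ← eLpNorm_two_sq, ← ENNReal.rpow_two,
        ← ENNReal.mul_rpow_of_nonneg _ _ zero_le_two]
      gcongr
      exact h2 f₂ hf₂ hf₂'
    have hs3 := hs.trans hs2
    have hind1 : ∫⁻ x, ‖f₁ x‖ₑ ∂μ = ∫⁻ x, S.indicator (fun x => ‖f x‖ₑ) x ∂μ := by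
      simp only [f₁, enorm_indicator_eq_indicator_enorm]
    have hind2 : ∫⁻ x, ‖f₂ x‖ₑ ^ (2 : ℝ) ∂μ =
        ∫⁻ x, {x | |f x| ≤ t}.indicator (fun x => ‖f x‖ₑ ^ (2 : ℝ)) x ∂μ := by
      rw [hSc]
      refine lintegral_congr fun x => ?_
      by_cases hx : x ∈ Sᶜ
      · simp only [f₂, indicator_of_mem hx]
      · simp [f₂, indicator_of_notMem hx]
    rw [hind1] at hw
    rw [hind2] at hs3
    have hsub : {x | t < |T f x| / 2} ⊆
        {x | ENNReal.ofReal t < ‖T f₁ x‖ₑ} ∪ {x | ENNReal.ofReal t < ‖T f₂ x‖ₑ} := by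
      intro x hx
      by_contra hcon
      simp only [mem_union, mem_ofPred_eq, not_or, not_lt, Real.enorm_eq_ofReal_abs] at hcon hx
      rw [ENNReal.ofReal_le_ofReal_iff ht.le, ENNReal.ofReal_le_ofReal_iff ht.le] at hcon
      rw [hadd, hT f₁ f₂ hf₁ hf₂] at hx
      have := abs_add_le (T f₁ x) (T f₂ x)
      linarith [hcon.1, hcon.2]
    generalize ∫⁻ x, S.indicator (fun x => ‖f x‖ₑ) x ∂μ = I₁ at *
    generalize ∫⁻ x, {x | |f x| ≤ t}.indicator (fun x => ‖f x‖ₑ ^ (2 : ℝ)) x ∂μ = I₂ at *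
    have hm := (measure_mono (μ := μ) hsub).trans (measure_union_le _ _)
    generalize μ {x | ENNReal.ofReal t < ‖T f₁ x‖ₑ} = V₁ at *
    generalize μ {x | ENNReal.ofReal t < ‖T f₂ x‖ₑ} = V₂ at *
    have e1 : ENNReal.ofReal (t ^ (p - 1)) = ENNReal.ofReal (t ^ (p - 2)) * ENNReal.ofReal t := by
      rw [← ENNReal.ofReal_mul (by positivity)]
      nth_rewrite 3 [← Real.rpow_one t]
      rw [← Real.rpow_add ht]
      congr 2; ring
    have e2 : ENNReal.ofReal (t ^ (p - 1)) =
        ENNReal.ofReal (t ^ (p - 3)) * ENNReal.ofReal t ^ (2 : ℝ) := by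
      rw [ENNReal.ofReal_rpow_of_pos ht, ← ENNReal.ofReal_mul (by positivity), ← Real.rpow_add ht]
      congr 2; ring
    calc μ {x | t < |T f x| / 2} * ENNReal.ofReal (t ^ (p - 1))
        ≤ (V₁ + V₂) * ENNReal.ofReal (t ^ (p - 1)) := by gcongr
      _ = ENNReal.ofReal (t ^ (p - 2)) * (ENNReal.ofReal t * V₁) +
          ENNReal.ofReal (t ^ (p - 3)) * (ENNReal.ofReal t ^ (2 : ℝ) * V₂) := by
          rw [add_mul]
          nth_rewrite 1 [e1]
          rw [e2]
          ring
      _ ≤ ENNReal.ofReal (t ^ (p - 2)) * (C₁ * I₁) +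
          ENNReal.ofReal (t ^ (p - 3)) * (C₂ ^ 2 * I₂) := by gcongr
      _ = _ := by ring
  -- The layer-cake formula is applied to |T f|/2 so that its levels match the cut height; this is
  -- the source of the factor 2^p.
  have hlay := lintegral_rpow_eq_lintegral_meas_lt_mul μ (f := fun x => |T f x| / 2)
    (Eventually.of_forall fun x => by positivity)
    (((hTm f hf).aemeasurable.norm).div_const 2) hp0
  have hhalf : ∫⁻ x, ‖T f x‖ₑ ^ p ∂μ =
      2 ^ p * ∫⁻ x, ENNReal.ofReal ((|T f x| / 2) ^ p) ∂μ := by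
    rw [← lintegral_const_mul' _ _ (by finiteness)]
    refine lintegral_congr fun x => ?_
    rw [← ENNReal.ofReal_rpow_of_nonneg (by positivity) hp0.le,
      ← ENNReal.mul_rpow_of_nonneg _ _ hp0.le, show (2 : ℝ≥0∞) = ENNReal.ofReal 2 by simp,
      ← ENNReal.ofReal_mul zero_le_two, Real.enorm_eq_ofReal_abs]
    congr 2
    ring
  rw [hhalf, hlay]
  have hF1 : Measurable fun t : ℝ => ENNReal.ofReal (t ^ (p - 2)) *
        ∫⁻ x, {x | t < |f x|}.indicator (fun x => ‖f x‖ₑ) x ∂μ := by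
    refine Measurable.mul (by fun_prop) ?_
    have hS : MeasurableSet {z : ℝ × α | z.1 < |f z.2|} :=
      measurableSet_lt measurable_fst (by fun_prop)
    exact Measurable.lintegral_prod_right'
      (f := {z : ℝ × α | z.1 < |f z.2|}.indicator (fun z => ‖f z.2‖ₑ))
      (Measurable.indicator (by fun_prop) hS)
  calc 2 ^ p * (ENNReal.ofReal p *
        ∫⁻ t in Ioi (0 : ℝ), μ {x | t < |T f x| / 2} * ENNReal.ofReal (t ^ (p - 1)))
      ≤ 2 ^ p * (ENNReal.ofReal p * ∫⁻ t in Ioi (0 : ℝ),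
        (C₁ * (ENNReal.ofReal (t ^ (p - 2)) *
          ∫⁻ x, {x | t < |f x|}.indicator (fun x => ‖f x‖ₑ) x ∂μ) +
        C₂ ^ 2 * (ENNReal.ofReal (t ^ (p - 3)) *
          ∫⁻ x, {x | |f x| ≤ t}.indicator (fun x => ‖f x‖ₑ ^ (2 : ℝ)) x ∂μ))) := by
        refine mul_le_mul_right (mul_le_mul_right ?_ _) _
        exact setLIntegral_mono' measurableSet_Ioi hset
    _ = _ := by
        rw [lintegral_add_left (hF1.const_mul _), lintegral_const_mul _ hF1,
          lintegral_const_mul' _ _ (by finiteness), lintegral_Ioi_tail_eq hfm hp1,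
          lintegral_Ioi_head_eq hfm hp0 hp2]
        ring

end Interpolation

/-! ### L^q bounds for Calderón–Zygmund kernels. -/

section LpBound

theorem eLpNorm_ofReal_eq {α : Type*} [MeasurableSpace α] {μ : Measure α} (f : α → ℝ) {p : ℝ}
    (hp : 0 < p) : eLpNorm f (ENNReal.ofReal p) μ = (∫⁻ x, ‖f x‖ₑ ^ p ∂μ) ^ (1 / p) := by
  rw [eLpNorm_eq_lintegral_rpow_enorm_toReal (by simp [hp]) (by simp), ENNReal.toReal_ofReal hp.le]

variable {n : ℕ}

theorem IsCZKernel.exists_eLpNorm_le_of_lt_two (hn : 1 ≤ n) (A : ℝ≥0) {p : ℝ} (hp1 : 1 < p)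
    (hp2 : p < 2) : ∃ C : ℝ≥0, ∀ K : EuclideanSpace ℝ (Fin n) → ℝ, IsCZKernel K A →
      ∀ f : EuclideanSpace ℝ (Fin n) → ℝ, Integrable f →
        eLpNorm (convOp K f) (ENNReal.ofReal p) ≤ C * eLpNorm f (ENNReal.ofReal p) := by
  have : Nonempty (Fin n) := ⟨⟨0, hn⟩⟩
  have hp0 : 0 < p := by linarith
  obtain ⟨C₁, hC₁⟩ := IsCZKernel.exists_weakType hn A
  obtain ⟨C₂, hC₂⟩ := IsCZKernel.exists_eLpNorm_two_le (E := EuclideanSpace ℝ (Fin n)) A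
  set B : ℝ≥0∞ := 2 ^ p * (ENNReal.ofReal p * (C₁ * ENNReal.ofReal (p - 1)⁻¹ +
      C₂ ^ 2 * ENNReal.ofReal (2 - p)⁻¹)) with hB
  have hBfin : B ^ (1 / p) ≠ ∞ := by
    refine ENNReal.rpow_ne_top_of_nonneg (by positivity) ?_
    rw [hB]
    finiteness
  refine ⟨(B ^ (1 / p)).toNNReal, fun K hK f hf => ?_⟩
  rw [ENNReal.coe_toNNReal hBfin]
  obtain ⟨M, hM⟩ := hK.exists_bound
  have hKs := hK.measurable.aestronglyMeasurable (μ := (volume : Measure (EuclideanSpace ℝ (Fin n))))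
  -- A genuinely measurable representative is needed for the joint level sets in the interpolation;
  -- convolution does not see the change.
  obtain ⟨g, hgm, hfg⟩ := hf.aemeasurable
  rw [convOp_congr_ae hfg, eLpNorm_congr_ae hfg, eLpNorm_ofReal_eq _ hp0, eLpNorm_ofReal_eq _ hp0,
    ← ENNReal.mul_rpow_of_nonneg _ _ (by positivity)]
  gcongr
  refine lintegral_rpow_le_of_weakType (T := convOp K)
    (fun f hf => aestronglyMeasurable_convOp hKs hf.1) (fun f g hf hg x => ?_) (hC₁ K hK) (hC₂ K hK)
    hp1 hp2 hgm (hf.congr hfg)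
  have h := convOp_sub hKs hM (hf.add hg) hg x
  rw [add_sub_cancel_right] at h
  linarith

/-- Fubini, legitimate because K is bounded and f and g are integrable: the adjoint is convolution
with the reflected kernel. -/
theorem IsCZKernel.integral_mul_convOp {K : EuclideanSpace ℝ (Fin n) → ℝ} {A : ℝ≥0}
    (hK : IsCZKernel K A) {f g : EuclideanSpace ℝ (Fin n) → ℝ} (hf : Integrable f)
    (hg : Integrable g) :
    ∫ x, convOp K f x * g x = ∫ y, f y * convOp (fun z => K (-z)) g y := by
  obtain ⟨M, hM⟩ := hK.exists_bound
  have hint : Integrable (fun z : EuclideanSpace ℝ (Fin n) × EuclideanSpace ℝ (Fin n) =>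
      K (z.1 - z.2) * (g z.1 * f z.2)) (volume.prod volume) := by
    refine (hg.mul_prod hf).bdd_mul (c := M) ?_ (Eventually.of_forall fun z => hM _)
    exact (hK.measurable.comp (measurable_fst.sub measurable_snd)).aestronglyMeasurable
  calc ∫ x, convOp K f x * g x = ∫ x, ∫ y, K (x - y) * (g x * f y) := by
        refine integral_congr_ae (Eventually.of_forall fun x => ?_)
        simp only [convOp]
        rw [← integral_mul_const]
        congr 1 with y
        ring
    _ = ∫ y, ∫ x, K (x - y) * (g x * f y) := integral_integral_swap hint
    _ = _ := by
        refine integral_congr_ae (Eventually.of_forall fun y => ?_)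
        simp only [convOp]
        rw [← integral_const_mul]
        congr 1 with x
        rw [neg_sub]
        ring

theorem enorm_integral_mul_le {α : Type*} [MeasurableSpace α] {μ : Measure α} {p q : ℝ}
    (hpq : q.HolderConjugate p) {f g : α → ℝ} (hf : AEStronglyMeasurable f μ)
    (hg : AEStronglyMeasurable g μ) :
    ‖∫ y, f y * g y ∂μ‖ₑ ≤ eLpNorm f (ENNReal.ofReal q) μ * eLpNorm g (ENNReal.ofReal p) μ := by
  rw [eLpNorm_ofReal_eq _ hpq.pos, eLpNorm_ofReal_eq _ hpq.symm.pos]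
  refine (enorm_integral_le_lintegral_enorm _).trans ?_
  simp only [enorm_mul]
  exact ENNReal.lintegral_mul_le_Lp_mul_Lq _ hpq hf.enorm hg.enorm

/-- Duality with the explicit extremizer g = |F|^(q-2) F for F = K * f. Since the conjugate exponent
p is below 2, the bound for the reflected kernel gives ∫|F|^q ≤ C ‖f‖_q (∫|F|^q)^(1/p), and dividing
finishes. -/
theorem IsCZKernel.exists_eLpNorm_le_of_two_lt (hn : 1 ≤ n) (A : ℝ≥0) {q : ℝ} (hq : 2 < q) :
    ∃ C : ℝ≥0, ∀ K : EuclideanSpace ℝ (Fin n) → ℝ, IsCZKernel K A →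
      ∀ f : EuclideanSpace ℝ (Fin n) → ℝ, Integrable f → MemLp f (ENNReal.ofReal q) →
        eLpNorm (convOp K f) (ENNReal.ofReal q) ≤ C * eLpNorm f (ENNReal.ofReal q) := by
  have hpq := Real.HolderConjugate.conjExponent (by linarith : 1 < q)
  set p := q.conjExponent with hp
  have hp1 : 1 < p := hpq.symm.lt
  have hp2 : p < 2 := by
    rw [hp, Real.conjExponent, div_lt_iff₀ (by linarith)]
    linarith
  have hp0 : 0 < p := by linarith
  have hq0 : 0 < q := by linarith
  obtain ⟨C, hC⟩ := IsCZKernel.exists_eLpNorm_le_of_lt_two hn A hp1 hp2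
  refine ⟨C, fun K hK f hf hfq => ?_⟩
  obtain ⟨M, hM⟩ := hK.exists_bound
  have hKs := hK.measurable.aestronglyMeasurable (μ := (volume : Measure (EuclideanSpace ℝ (Fin n))))
  set F := convOp K f with hF
  have hF1 : Integrable F := integrable_convOp hK.integrable hf
  have hFq : MemLp F (ENNReal.ofReal q) := memLp_convOp hK.integrable (by linarith) hfq
  set g : EuclideanSpace ℝ (Fin n) → ℝ := fun x => |F x| ^ (q - 2) * F x with hg
  have hFb : ∀ x, |F x| ≤ M * ∫ y, |f y| := by
    intro x
    rw [hF, convOp, ← integral_const_mul]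
    refine (abs_integral_le_integral_abs).trans (integral_mono_of_nonneg
      (Eventually.of_forall fun y => abs_nonneg _) (hf.abs.const_mul _)
      (Eventually.of_forall fun y => ?_))
    simp only [abs_mul]
    gcongr
    exact hM _
  -- F is bounded because K is bounded and f is integrable, so for q > 2 the factor |F|^(q-2) is
  -- bounded too.
  have hgi : Integrable g := by
    refine hF1.bdd_mul (c := (M * ∫ y, |f y|) ^ (q - 2)) ?_ (Eventually.of_forall fun x => ?_)
    · exact (hF1.aemeasurable.norm.pow_const _).aestronglyMeasurable
    · rw [Real.norm_of_nonneg (by positivity)]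
      exact Real.rpow_le_rpow (abs_nonneg _) (hFb x) (by linarith)
  have hgabs : ∀ x, |g x| = |F x| ^ (q - 1) := by
    intro x
    simp only [hg]
    rw [abs_mul, abs_of_nonneg (by positivity)]
    nth_rewrite 2 [← Real.rpow_one |F x|]
    rw [← Real.rpow_add_of_nonneg (abs_nonneg _) (by linarith) zero_le_one]
    congr 1; ring
  have hgp : ∀ x, ‖g x‖ₑ ^ p = ‖F x‖ₑ ^ q := by
    intro x
    rw [Real.enorm_eq_ofReal_abs, Real.enorm_eq_ofReal_abs, hgabs,
      ← ENNReal.ofReal_rpow_of_nonneg (abs_nonneg _) (by linarith), ← ENNReal.rpow_mul]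
    congr 1
    rw [hp, Real.conjExponent]
    field_simp
    rw [div_self (by linarith)]
  have hFg : ∀ x, F x * g x = |F x| ^ q := by
    intro x
    simp only [hg]
    rw [mul_left_comm, ← abs_mul_abs_self, ← sq, ← Real.rpow_natCast,
      ← Real.rpow_add_of_nonneg (abs_nonneg _) (by linarith) (by norm_num)]
    congr 1
    push_cast
    ring
  set I : ℝ≥0∞ := ∫⁻ x, ‖F x‖ₑ ^ q with hI
  -- Finiteness comes from Young with the non-uniform constant ‖K‖₁; it is what permits the final
  -- division.
  have hIfin : I ≠ ∞ := by
    have h := hFq.2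
    rw [eLpNorm_ofReal_eq _ hq0] at h
    exact ((ENNReal.rpow_lt_top_iff_of_pos (by positivity)).1 h).ne
  have hIeq : I = ‖∫ x, F x * g x‖ₑ := by
    have hm : AEStronglyMeasurable (fun x => |F x| ^ q) :=
      (hF1.aemeasurable.norm.pow_const _).aestronglyMeasurable
    have h1 : ∫ x, F x * g x = I.toReal := by
      simp only [hFg]
      rw [integral_eq_lintegral_of_nonneg_ae (Eventually.of_forall fun x => by positivity) hm, hI]
      congr 2 with x
      rw [Real.enorm_eq_ofReal_abs, ENNReal.ofReal_rpow_of_nonneg (abs_nonneg _) hq0.le]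
    rw [h1, Real.enorm_of_nonneg ENNReal.toReal_nonneg, ENNReal.ofReal_toReal hIfin]
  have hmain : I ≤ C * eLpNorm f (ENNReal.ofReal q) * I ^ (1 / p) := by
    have hKn := hK.comp_neg
    have hKns := hKn.measurable.aestronglyMeasurable
      (μ := (volume : Measure (EuclideanSpace ℝ (Fin n))))
    have h1 := enorm_integral_mul_le hpq hf.1 (aestronglyMeasurable_convOp hKns hgi.1)
    rw [← hK.integral_mul_convOp hf hgi, ← hIeq] at h1
    have h2 := hC _ hKn g hgi
    have h3 : eLpNorm g (ENNReal.ofReal p) = I ^ (1 / p) := by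
      rw [eLpNorm_ofReal_eq g hp0]
      simp only [hgp, hI]
    rw [h3] at h2
    rw [mul_right_comm, mul_comm]
    exact h1.trans (mul_le_mul_right h2 _)
  rw [eLpNorm_ofReal_eq F hq0, ← hI]
  by_cases hI0 : I = 0
  · rw [hI0, ENNReal.zero_rpow_of_pos (by positivity)]
    exact zero_le
  have hIp0 : I ^ (1 / p) ≠ 0 := by simp [hI0, hIfin]
  have hIpf : I ^ (1 / p) ≠ ∞ := ENNReal.rpow_ne_top_of_nonneg (by positivity) hIfin
  have hsplit : I = I ^ (1 / q) * I ^ (1 / p) := by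
    rw [← ENNReal.rpow_add _ _ hI0 hIfin, one_div, one_div, hpq.inv_add_inv_eq_one,
      ENNReal.rpow_one]
  refine (ENNReal.mul_le_mul_iff_left hIp0 hIpf).1 ?_
  rwa [← hsplit]

/-- Calderón–Zygmund kernels are of strong type `(q, q)`, uniformly in the kernel. -/
theorem IsCZKernel.exists_eLpNorm_le (hn : 1 ≤ n) (A : ℝ≥0) {q : ℝ} (hq : 1 < q) :
    ∃ C : ℝ≥0, ∀ K : EuclideanSpace ℝ (Fin n) → ℝ, IsCZKernel K A →
      ∀ f : EuclideanSpace ℝ (Fin n) → ℝ, Integrable f → MemLp f (ENNReal.ofReal q) →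
        eLpNorm (convOp K f) (ENNReal.ofReal q) ≤ C * eLpNorm f (ENNReal.ofReal q) := by
  have : Nonempty (Fin n) := ⟨⟨0, hn⟩⟩
  rcases lt_trichotomy q 2 with h | rfl | h
  · obtain ⟨C, hC⟩ := IsCZKernel.exists_eLpNorm_le_of_lt_two hn A hq h
    exact ⟨C, fun K hK f hf _ => hC K hK f hf⟩
  · obtain ⟨C, hC⟩ := IsCZKernel.exists_eLpNorm_two_le (E := EuclideanSpace ℝ (Fin n)) A
    refine ⟨C, fun K hK f hf hf2 => ?_⟩
    rw [show ENNReal.ofReal 2 = 2 by simp] at hf2 ⊢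
    exact hC K hK f hf hf2
  · exact IsCZKernel.exists_eLpNorm_le_of_two_lt hn A h

end LpBound

/-! ### Consequences of the Dini condition. -/

section DiniKernel

theorem norm_normalize_sub_le {E : Type*} [NormedAddCommGroup E] [NormedSpace ℝ E] {x y : E}
    (hx : x ≠ 0) (hy : y ≠ 0) : ‖‖x‖⁻¹ • x - ‖y‖⁻¹ • y‖ ≤ 2 * ‖x - y‖ / ‖y‖ := by
  have hx' : 0 < ‖x‖ := norm_pos_iff.2 hx
  have hy' : 0 < ‖y‖ := norm_pos_iff.2 hy
  have h1 : ‖x‖⁻¹ • x - ‖y‖⁻¹ • y = (‖x‖⁻¹ - ‖y‖⁻¹) • x + ‖y‖⁻¹ • (x - y) := by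
    rw [sub_smul, smul_sub]; abel
  have h2 : ‖(‖x‖⁻¹ - ‖y‖⁻¹) • x‖ ≤ ‖x - y‖ / ‖y‖ := by
    have h : ‖(‖x‖⁻¹ - ‖y‖⁻¹) • x‖ * ‖y‖ = |(‖x‖⁻¹ - ‖y‖⁻¹) * ‖x‖ * ‖y‖| := by
      rw [norm_smul, abs_mul, abs_mul, abs_norm, abs_norm, Real.norm_eq_abs]
    rw [le_div_iff₀ hy', h, show (‖x‖⁻¹ - ‖y‖⁻¹) * ‖x‖ * ‖y‖ = ‖y‖ - ‖x‖ by field_simp,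
      norm_sub_rev]
    exact abs_norm_sub_norm_le y x
  have h3 : ‖‖y‖⁻¹ • (x - y)‖ = ‖x - y‖ / ‖y‖ := by
    rw [norm_smul, norm_inv, norm_norm, inv_mul_eq_div]
  rw [h1]
  refine (norm_add_le _ _).trans ?_
  rw [h3, two_mul, add_div]
  gcongr

variable {n : ℕ} {Ω : EuclideanSpace ℝ (Fin n) → ℝ}

theorem monotone_sphereModulus (Ω : EuclideanSpace ℝ (Fin n) → ℝ) : Monotone (sphereModulus Ω) := by
  intro δ δ' h
  refine iSup_mono fun x => iSup_mono fun x' => iSup_mono fun _ => iSup_mono fun _ => ?_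
  exact iSup_mono' fun h' => ⟨h'.trans h, le_rfl⟩

variable {B₁ B₂ : ℝ}

theorem IsDiniKernel.enorm_sub_le (hΩ : IsDiniKernel Ω B₁ B₂) {x y : EuclideanSpace ℝ (Fin n)}
    (hx : x ≠ 0) (hy : y ≠ 0) {δ : ℝ} (h : ‖‖x‖⁻¹ • x - ‖y‖⁻¹ • y‖ ≤ δ) :
    ‖Ω x - Ω y‖ₑ ≤ sphereModulus Ω δ := by
  have hx' : 0 < ‖x‖ := norm_pos_iff.2 hx
  have hy' : 0 < ‖y‖ := norm_pos_iff.2 hy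
  rw [← hΩ.homogeneous _ (inv_pos.2 hx') x hx, ← hΩ.homogeneous _ (inv_pos.2 hy') y hy,
    Real.enorm_eq_ofReal_abs]
  have hn : ∀ z : EuclideanSpace ℝ (Fin n), z ≠ 0 → ‖‖z‖⁻¹ • z‖ = 1 := fun z hz => by
    rw [norm_smul, norm_inv, norm_norm, inv_mul_cancel₀ (norm_ne_zero_iff.2 hz)]
  unfold sphereModulus
  refine le_iSup_of_le (‖x‖⁻¹ • x) (le_iSup_of_le (‖y‖⁻¹ • y) ?_)
  exact le_iSup_of_le (hn x hx) (le_iSup_of_le (hn y hy) (le_iSup_of_le h le_rfl))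

theorem lintegral_Ioc_inv_eq_top :
    ∫⁻ δ in Ioc (0 : ℝ) 1, (ENNReal.ofReal δ)⁻¹ = ∞ := by
  by_contra h
  have hint : IntegrableOn (fun δ : ℝ => δ⁻¹) (Ioc 0 1) := by
    refine ⟨measurable_inv.aestronglyMeasurable, ?_⟩
    refine lt_of_le_of_lt (le_of_eq ?_) (lt_top_iff_ne_top.2 h)
    refine setLIntegral_congr_fun measurableSet_Ioc fun δ hδ => ?_
    simp only
    rw [Real.enorm_of_nonneg (inv_nonneg.2 hδ.1.le), ENNReal.ofReal_inv_of_pos hδ.1]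
  have h2 := (intervalIntegrable_iff_integrableOn_Ioc_of_le zero_le_one).2 hint
  rw [intervalIntegrable_inv_iff] at h2
  simp at h2

/-- If ω stayed above η, the Dini integral would dominate η ∫₀¹ dδ/δ = ∞. -/
theorem IsDiniKernel.exists_sphereModulus_le (hΩ : IsDiniKernel Ω B₁ B₂) {η : ℝ≥0∞} (hη : η ≠ 0) :
    ∃ δ > 0, sphereModulus Ω δ ≤ η := by
  by_contra! hcon
  have h1 : η * ∫⁻ δ in Ioc (0 : ℝ) 1, (ENNReal.ofReal δ)⁻¹ ≤
      ∫⁻ δ in Ioc (0 : ℝ) 1, sphereModulus Ω δ / ENNReal.ofReal δ := by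
    rw [← lintegral_const_mul _ (by fun_prop)]
    refine setLIntegral_mono' measurableSet_Ioc fun δ hδ => ?_
    rw [div_eq_mul_inv]
    gcongr
    exact (hcon δ hδ.1).le
  rw [lintegral_Ioc_inv_eq_top, ENNReal.mul_top hη] at h1
  exact absurd (h1.trans hΩ.dini) (by simp)

/-- Since ω is arbitrarily small at small scales and radial projection is continuous off 0,
homogeneity extends continuity from the sphere. Measurability of Ω off 0, which is not assumed,
follows from this. -/
theorem IsDiniKernel.continuousOn (hΩ : IsDiniKernel Ω B₁ B₂) : ContinuousOn Ω {0}ᶜ := by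
  intro x hx
  have hx0 : x ≠ 0 := hx
  refine ContinuousAt.continuousWithinAt ?_
  rw [ContinuousAt, tendsto_iff_edist_tendsto_0, ENNReal.tendsto_nhds_zero]
  intro η hη
  obtain ⟨δ, hδ, hδη⟩ := hΩ.exists_sphereModulus_le hη.ne'
  have hc : ContinuousAt (fun y : EuclideanSpace ℝ (Fin n) => ‖y‖⁻¹ • y) x :=
    (continuousAt_id.norm.inv₀ (norm_ne_zero_iff.2 hx0)).smul continuousAt_id
  filter_upwards [hc.eventually (ball_mem_nhds _ hδ), isOpen_compl_singleton.mem_nhds hx0]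
    with y hy hy0
  rw [edist_eq_enorm_sub]
  refine (hΩ.enorm_sub_le hy0 hx0 (δ := δ) ?_).trans hδη
  rw [← dist_eq_norm]
  exact hy.le

theorem IsDiniKernel.measurable_indicator (hΩ : IsDiniKernel Ω B₁ B₂) :
    Measurable (({0}ᶜ : Set (EuclideanSpace ℝ (Fin n))).indicator Ω) := by
  classical
  have := hΩ.continuousOn.measurable_piecewise (g := fun _ => (0 : ℝ)) continuousOn_const
    (measurableSet_singleton (0 : EuclideanSpace ℝ (Fin n))).compl
  exact (piecewise_eq_indicator (f := Ω) (s := {0}ᶜ)) ▸ this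

/-- The kernel `Ω(y) |y|^(β - n)` restricted to the set of those `y` with `|y| ∈ I`. -/
noncomputable def radialRestrict (Ω : EuclideanSpace ℝ (Fin n) → ℝ) (β : ℝ) (I : Set ℝ) :
    EuclideanSpace ℝ (Fin n) → ℝ :=
  {y | ‖y‖ ∈ I}.indicator fun y => Ω y / ‖y‖ ^ ((n : ℝ) - β)

theorem IsDiniKernel.measurable_radialRestrict (hΩ : IsDiniKernel Ω B₁ B₂) (β : ℝ) {I : Set ℝ}
    (hI : MeasurableSet I) (h0 : (0 : ℝ) ∉ I) : Measurable (radialRestrict Ω β I) := by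
  have h : radialRestrict Ω β I = {y | ‖y‖ ∈ I}.indicator fun y =>
      ({0}ᶜ : Set (EuclideanSpace ℝ (Fin n))).indicator Ω y / ‖y‖ ^ ((n : ℝ) - β) := by
    refine indicator_congr fun y hy => ?_
    have hy0 : y ≠ 0 := by rintro rfl; exact h0 (by simpa using hy)
    rw [indicator_of_mem (show y ∈ ({0}ᶜ : Set (EuclideanSpace ℝ (Fin n))) from hy0)]
  rw [h]
  exact (hΩ.measurable_indicator.div (by fun_prop)).indicator (measurable_norm hI)

/-- The measure dr/r is invariant under r ↦ ρ/r, which exchanges [ρ, ∞) and (0, 1]. This is how the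
Hörmander integral becomes the Dini integral. -/
theorem lintegral_Ici_comp_div {φ : ℝ → ℝ≥0∞} {ρ : ℝ} (hρ : 0 < ρ) :
    ∫⁻ r in Ici ρ, φ (ρ / r) / ENNReal.ofReal r = ∫⁻ δ in Ioc (0 : ℝ) 1, φ δ / ENNReal.ofReal δ := by
  have himg : (fun δ : ℝ => ρ / δ) '' Ioc 0 1 = Ici ρ := by
    ext r
    constructor
    · rintro ⟨δ, hδ, rfl⟩
      rw [mem_Ici, le_div_iff₀ hδ.1]
      exact mul_le_of_le_one_right hρ.le hδ.2
    · intro hr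
      have hr0 : 0 < r := hρ.trans_le hr
      refine ⟨ρ / r, ⟨by positivity, (div_le_one hr0).2 hr⟩, ?_⟩
      simp only
      field_simp
  rw [← himg, lintegral_image_eq_lintegral_abs_deriv_mul measurableSet_Ioc
    (f' := fun δ => -ρ / δ ^ 2)]
  · refine setLIntegral_congr_fun measurableSet_Ioc fun δ hδ => ?_
    have hδ0 : 0 < δ := hδ.1
    rw [div_div_cancel₀ hρ.ne', neg_div, abs_neg, abs_of_pos (by positivity), div_eq_mul_inv (φ δ),
      div_eq_mul_inv (φ δ), mul_left_comm, ← ENNReal.ofReal_inv_of_pos (by positivity),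
      ← ENNReal.ofReal_inv_of_pos (by positivity), ← ENNReal.ofReal_mul (by positivity)]
    congr 2
    field_simp
  · intro δ hδ
    have h := ((hasDerivAt_inv hδ.1.ne').const_mul ρ).hasDerivWithinAt (s := Ioc 0 1)
    simp only [← div_eq_mul_inv] at h
    refine h.congr_deriv ?_
    rw [mul_neg, neg_div, neg_inj, div_eq_mul_inv]
  · intro x hx y hy hxy
    simp only at hxy
    have := hx.1
    have := hy.1
    field_simp at hxy
    exact hxy.symm

/-- The crude bound 1/r ≤ 2/a on an interval of length 3a/2 suffices; the point is that it does not
depend on a. -/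
theorem setLIntegral_Icc_inv_le {a : ℝ} (ha : 0 < a) :
    ∫⁻ r in Ioi (0 : ℝ), (Icc (a / 2) (2 * a)).indicator (1 : ℝ → ℝ≥0∞) r / ENNReal.ofReal r ≤ 3 := by
  calc _ ≤ ∫⁻ r in Ioi (0 : ℝ), (Icc (a / 2) (2 * a)).indicator
        (fun _ => ENNReal.ofReal (2 / a)) r := by
        refine setLIntegral_mono' measurableSet_Ioi fun r (hr : 0 < r) => ?_
        by_cases h : r ∈ Icc (a / 2) (2 * a)
        · rw [indicator_of_mem h, indicator_of_mem h, Pi.one_apply, one_div,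
            ← ENNReal.ofReal_inv_of_pos hr]
          refine ENNReal.ofReal_le_ofReal ?_
          rw [inv_le_comm₀ hr (by positivity), inv_div]
          exact h.1
        · rw [indicator_of_notMem h]; simp
    _ ≤ ∫⁻ r, (Icc (a / 2) (2 * a)).indicator (fun _ => ENNReal.ofReal (2 / a)) r :=
        setLIntegral_le_lintegral _ _
    _ = ENNReal.ofReal (2 / a) * ENNReal.ofReal (2 * a - a / 2) := by
        rw [lintegral_indicator measurableSet_Icc, setLIntegral_const, Real.volume_Icc]
    _ ≤ 3 := by
        rw [← ENNReal.ofReal_mul (by positivity), show 2 / a * (2 * a - a / 2) = 3 by field_simp; norm_num]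
        simp

/-- Comparison of negative powers of nearby numbers. -/
theorem abs_inv_rpow_sub_inv_rpow_le {γ u v : ℝ} {n : ℕ} (hγ0 : 0 ≤ γ) (hγ : γ ≤ n) (hu : 0 < u)
    (huv : u ≤ v) : |1 / u ^ γ - 1 / v ^ γ| ≤ 1 / u ^ γ * (n * ((v - u) / v)) := by
  have hv : 0 < v := hu.trans_le huv
  have ht0 : 0 < u / v := by positivity
  have ht1 : u / v ≤ 1 := (div_le_one hv).2 huv
  have h1 : 1 / v ^ γ = 1 / u ^ γ * (u / v) ^ γ := by
    rw [Real.div_rpow hu.le hv.le]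
    have : 0 < u ^ γ := by positivity
    field_simp
  have h2 : (u / v) ^ n ≤ (u / v) ^ γ := by
    rw [← Real.rpow_natCast]
    exact Real.rpow_le_rpow_of_exponent_ge ht0 ht1 hγ
  -- Bernoulli's inequality for the integer exponent n; (u/v)^γ is larger still because u/v ≤ 1 and
  -- γ ≤ n.
  have h3 : 1 + n * (u / v - 1) ≤ (u / v) ^ n := by
    have := one_add_mul_le_pow (a := u / v - 1) (by linarith) n
    rwa [add_sub_cancel] at this
  have h4 : (u / v) ^ γ ≤ 1 := Real.rpow_le_one ht0.le ht1 hγ0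
  have h5 : (v - u) / v = 1 - u / v := by field_simp
  have h6 : 0 < 1 / u ^ γ := by positivity
  rw [h1, ← mul_one_sub, abs_of_nonneg (mul_nonneg h6.le (by linarith)), h5]
  gcongr
  linarith

end DiniKernel

/-! ### The near part is a Calderón–Zygmund kernel. -/

section NearKernel

variable {n : ℕ} {Ω : EuclideanSpace ℝ (Fin n) → ℝ} {B₁ B₂ : ℝ}

/-- A bound r^β ≤ H is all that is needed to treat |y|^(β-n) as the critical power |y|^(-n). -/
theorem one_div_rpow_sub_le {n : ℕ} {β H b r : ℝ} (hH : ∀ r, 0 < r → r < b → r ^ β ≤ H) (hr : 0 < r)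
    (hrb : r < b) : 1 / r ^ ((n : ℝ) - β) ≤ H / r ^ n := by
  rw [Real.rpow_sub hr, Real.rpow_natCast, one_div_div]
  gcongr
  exact hH r hr hrb

theorem IsDiniKernel.abs_radialRestrict_le (hΩ : IsDiniKernel Ω B₁ B₂) {β H a b : ℝ}
    (hH : ∀ r, 0 < r → r < b → r ^ β ≤ H) (hB₁ : 0 ≤ B₁) (hH0 : 0 ≤ H) (ha : 0 < a)
    (y : EuclideanSpace ℝ (Fin n)) :
    |radialRestrict Ω β (Ico a b) y| ≤ B₁ * (H / ‖y‖ ^ n) := by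
  by_cases hy : ‖y‖ ∈ Ico a b
  · have hy0 : 0 < ‖y‖ := ha.trans_le hy.1
    rw [radialRestrict, indicator_of_mem (show y ∈ {y | ‖y‖ ∈ Ico a b} from hy), div_eq_mul_one_div,
      abs_mul, abs_of_nonneg (by positivity : 0 ≤ 1 / ‖y‖ ^ ((n : ℝ) - β))]
    exact mul_le_mul (hΩ.bounded y (norm_pos_iff.1 hy0)) (one_div_rpow_sub_le hH hy0 hy.2)
      (by positivity) hB₁
  · rw [radialRestrict, indicator_of_notMem (show y ∉ {y | ‖y‖ ∈ Ico a b} from hy), abs_zero]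
    positivity

/-- The radial majorant in the Hörmander condition, as a function of `r = ‖y‖` and `ρ = 2 ‖h‖`. -/
noncomputable def hormanderMajorant (Ω : EuclideanSpace ℝ (Fin n) → ℝ) (a b ρ r : ℝ) : ℝ≥0∞ :=
  sphereModulus Ω (ρ / r) + ENNReal.ofReal (ρ / r) +
    (Icc (a / 2) (2 * a)).indicator (1 : ℝ → ℝ≥0∞) r +
    (Icc (b / 2) (2 * b)).indicator (1 : ℝ → ℝ≥0∞) r

/-- With both points in the annulus, the difference splits into a change of angle, measured by ω at
the distance of the normalized vectors, and a change of radius, controlled by comparing the powers.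
The factor 2^n comes from ‖z‖ ≥ ‖y‖/2. -/
theorem IsDiniKernel.enorm_radialRestrict_sub_le_of_mem (hΩ : IsDiniKernel Ω B₁ B₂) {β H a b : ℝ}
    (hH : ∀ r, 0 < r → r < b → r ^ β ≤ H) (hβ0 : 0 ≤ β) (hβ : β ≤ n) (hB₁ : 0 ≤ B₁) (hH0 : 0 ≤ H)
    (ha : 0 < a) {y z : EuclideanSpace ℝ (Fin n)} (hy : ‖y‖ ∈ Ico a b) (hz : ‖z‖ ∈ Ico a b)
    (hyz : 2 * ‖z - y‖ ≤ ‖y‖) :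
    ‖radialRestrict Ω β (Ico a b) z - radialRestrict Ω β (Ico a b) y‖ₑ ≤
      ENNReal.ofReal ((1 + B₁ * n + B₁) * (H * 2 ^ n / ‖y‖ ^ n)) *
      (sphereModulus Ω (2 * ‖z - y‖ / ‖y‖) + ENNReal.ofReal (2 * ‖z - y‖ / ‖y‖)) := by
  have hy0 : 0 < ‖y‖ := ha.trans_le hy.1
  have hz0 : 0 < ‖z‖ := ha.trans_le hz.1
  have hzy : ‖y‖ ≤ ‖z‖ + ‖z - y‖ := by
    have := norm_sub_norm_le y z
    rw [norm_sub_rev] at this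
    linarith
  have hyz' : ‖z‖ ≤ ‖y‖ + ‖z - y‖ := by
    have := norm_sub_norm_le z y
    linarith
  set γ : ℝ := (n : ℝ) - β with hγ
  set D : ℝ := H * 2 ^ n / ‖y‖ ^ n with hD
  have hD0 : 0 ≤ D := by positivity
  have hbound : ∀ r, ‖y‖ / 2 ≤ r → r < b → 1 / r ^ γ ≤ D := by
    intro r hr hrb
    have hr0 : 0 < r := by linarith
    refine (one_div_rpow_sub_le hH hr0 hrb).trans ?_
    rw [hD, div_le_div_iff₀ (by positivity) (by positivity), mul_assoc, ← mul_pow]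
    gcongr
    linarith
  rw [radialRestrict, indicator_of_mem (show z ∈ {y | ‖y‖ ∈ Ico a b} from hz),
    indicator_of_mem (show y ∈ {y | ‖y‖ ∈ Ico a b} from hy)]
  have hsplit : Ω z / ‖z‖ ^ γ - Ω y / ‖y‖ ^ γ =
      (Ω z - Ω y) * (1 / ‖z‖ ^ γ) + Ω y * (1 / ‖z‖ ^ γ - 1 / ‖y‖ ^ γ) := by ring
  have hdiff : |1 / ‖z‖ ^ γ - 1 / ‖y‖ ^ γ| ≤ D * (n * (‖z - y‖ / ‖y‖)) := by
    have hγ0 : 0 ≤ γ := by rw [hγ]; linarith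
    have hγn : γ ≤ n := by rw [hγ]; linarith
    rcases le_total ‖z‖ ‖y‖ with h | h
    · refine (abs_inv_rpow_sub_inv_rpow_le hγ0 hγn hz0 h).trans ?_
      gcongr
      · exact hbound _ (by linarith) hz.2
      · linarith
    · rw [abs_sub_comm]
      refine (abs_inv_rpow_sub_inv_rpow_le hγ0 hγn hy0 h).trans ?_
      have h1 : (‖z‖ - ‖y‖) / ‖z‖ ≤ ‖z - y‖ / ‖y‖ :=
        div_le_div₀ (norm_nonneg _) (by linarith) hy0 h
      gcongr
      exact hbound _ (by linarith) hy.2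
  rw [hsplit]
  refine (enorm_add_le _ _).trans ?_
  rw [mul_add]
  gcongr ?_ + ?_
  · rw [enorm_mul, mul_comm]
    gcongr
    · rw [Real.enorm_of_nonneg (by positivity)]
      refine ENNReal.ofReal_le_ofReal ?_
      calc 1 / ‖z‖ ^ γ ≤ 1 * D := by
            rw [one_mul]
            exact hbound _ (by linarith) hz.2
        _ ≤ _ := by
            gcongr
            have : 0 ≤ B₁ * n := by positivity
            linarith
    · exact hΩ.enorm_sub_le (norm_pos_iff.1 hz0) (norm_pos_iff.1 hy0)
        (norm_normalize_sub_le (norm_pos_iff.1 hz0) (norm_pos_iff.1 hy0))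
  · rw [← ENNReal.ofReal_mul (by positivity), Real.enorm_eq_ofReal_abs, abs_mul]
    refine ENNReal.ofReal_le_ofReal ?_
    calc |Ω y| * |1 / ‖z‖ ^ γ - 1 / ‖y‖ ^ γ| ≤ B₁ * (D * (n * (‖z - y‖ / ‖y‖))) := by
          gcongr
          exact hΩ.bounded y (norm_pos_iff.1 hy0)
      _ = (B₁ * n) * D * (‖z - y‖ / ‖y‖) := by ring
      _ ≤ (1 + B₁ * n + B₁) * D * (2 * ‖z - y‖ / ‖y‖) := by
          gcongr
          · linarith
          · linarith [norm_nonneg (z - y)]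

/-- If exactly one of the two points lies in the annulus there is no smoothness to use, but their
norms are comparable within a factor 2, so ‖y‖ is within a factor 2 of a or b. There an indicator in
the majorant equals 1 and the size bound is enough. -/
theorem IsDiniKernel.enorm_radialRestrict_sub_le (hΩ : IsDiniKernel Ω B₁ B₂) {β H a b : ℝ}
    (hH : ∀ r, 0 < r → r < b → r ^ β ≤ H) (hβ0 : 0 ≤ β) (hβ : β ≤ n) (hB₁ : 0 ≤ B₁) (hH0 : 0 ≤ H)
    (ha : 0 < a) {y z : EuclideanSpace ℝ (Fin n)} (hy0 : y ≠ 0) (hyz : 2 * ‖z - y‖ ≤ ‖y‖) :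
    ‖radialRestrict Ω β (Ico a b) z - radialRestrict Ω β (Ico a b) y‖ₑ ≤
      ENNReal.ofReal ((1 + B₁ * n + B₁) * (H * 2 ^ n / ‖y‖ ^ n)) *
      hormanderMajorant Ω a b (2 * ‖z - y‖) ‖y‖ := by
  have hy0' : 0 < ‖y‖ := norm_pos_iff.2 hy0
  have hzy : ‖y‖ ≤ ‖z‖ + ‖z - y‖ := by
    have := norm_sub_norm_le y z
    rw [norm_sub_rev] at this
    linarith
  have hyz' : ‖z‖ ≤ ‖y‖ + ‖z - y‖ := by
    have := norm_sub_norm_le z y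
    linarith
  have hz0' : 0 < ‖z‖ := by linarith
  set D : ℝ := H * 2 ^ n / ‖y‖ ^ n with hD
  have hD0 : 0 ≤ D := by positivity
  have hsize : ∀ w : EuclideanSpace ℝ (Fin n), ‖y‖ / 2 ≤ ‖w‖ →
      |radialRestrict Ω β (Ico a b) w| ≤ (1 + B₁ * n + B₁) * D := by
    intro w hw
    have hw0 : 0 < ‖w‖ := by linarith
    refine (hΩ.abs_radialRestrict_le hH hB₁ hH0 ha w).trans ?_
    have h1 : H / ‖w‖ ^ n ≤ D := by
      rw [hD, div_le_div_iff₀ (by positivity) (by positivity), mul_assoc, ← mul_pow]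
      gcongr
      linarith
    have : 0 ≤ B₁ * n := by positivity
    gcongr
    linarith
  have hone : 1 ≤ (Icc (a / 2) (2 * a)).indicator (1 : ℝ → ℝ≥0∞) ‖y‖ +
      (Icc (b / 2) (2 * b)).indicator (1 : ℝ → ℝ≥0∞) ‖y‖ →
      1 ≤ hormanderMajorant Ω a b (2 * ‖z - y‖) ‖y‖ := fun h => by
    rw [hormanderMajorant, add_assoc]
    exact h.trans le_add_self
  have hina : ‖y‖ ∈ Icc (a / 2) (2 * a) → 1 ≤ hormanderMajorant Ω a b (2 * ‖z - y‖) ‖y‖ := fun h =>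
    hone (by rw [indicator_of_mem h]; exact le_self_add)
  have hinb : ‖y‖ ∈ Icc (b / 2) (2 * b) → 1 ≤ hormanderMajorant Ω a b (2 * ‖z - y‖) ‖y‖ := fun h =>
    hone (by rw [indicator_of_mem h]; exact le_add_self)
  have hnot : ∀ w : EuclideanSpace ℝ (Fin n), ‖w‖ ∉ Ico a b → radialRestrict Ω β (Ico a b) w = 0 :=
    fun w hw => indicator_of_notMem (show w ∉ {y | ‖y‖ ∈ Ico a b} from hw) _
  have hfin : ∀ w : EuclideanSpace ℝ (Fin n), ‖y‖ / 2 ≤ ‖w‖ →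
      1 ≤ hormanderMajorant Ω a b (2 * ‖z - y‖) ‖y‖ →
      ‖radialRestrict Ω β (Ico a b) w‖ₑ ≤ ENNReal.ofReal ((1 + B₁ * n + B₁) * D) *
        hormanderMajorant Ω a b (2 * ‖z - y‖) ‖y‖ := by
    intro w hw h1
    rw [Real.enorm_eq_ofReal_abs]
    exact (ENNReal.ofReal_le_ofReal (hsize w hw)).trans (le_mul_of_one_le_right zero_le h1)
  by_cases hy : ‖y‖ ∈ Ico a b
  · by_cases hz : ‖z‖ ∈ Ico a b
    · refine (hΩ.enorm_radialRestrict_sub_le_of_mem hH hβ0 hβ hB₁ hH0 ha hy hz hyz).trans ?_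
      gcongr
      rw [hormanderMajorant, add_assoc (_ + _)]
      exact le_self_add
    · rw [hnot z hz, zero_sub, enorm_neg]
      refine hfin y (by linarith) ?_
      rw [mem_Ico, not_and_or, not_le, not_lt] at hz
      rcases hz with hz | hz
      · exact hina ⟨by linarith [hy.1], by linarith⟩
      · exact hinb ⟨by linarith, by linarith [hy.2]⟩
  · rw [hnot y hy, sub_zero]
    by_cases hz : ‖z‖ ∈ Ico a b
    · refine hfin z (by linarith) ?_
      rw [mem_Ico, not_and_or, not_le, not_lt] at hy
      rcases hy with hy | hy
      · exact hina ⟨by linarith [hz.1], by linarith⟩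
      · exact hinb ⟨by linarith [hz.1], by linarith [hz.2]⟩
    · rw [hnot z hz, enorm_zero]
      exact zero_le

/-- Against dr/r the four terms of the majorant contribute at most B₂, 1, 3 and 3. -/
theorem IsDiniKernel.lintegral_hormanderMajorant_le (hΩ : IsDiniKernel Ω B₁ B₂) {a b ρ : ℝ}
    (ha : 0 < a) (hb : 0 < b) (hρ : 0 < ρ) :
    ∫⁻ r in Ioi (0 : ℝ), (Ici ρ).indicator (hormanderMajorant Ω a b ρ) r / ENNReal.ofReal r ≤
      ENNReal.ofReal B₂ + 7 := by
  have hmω : Measurable fun r => sphereModulus Ω (ρ / r) :=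
    (monotone_sphereModulus Ω).measurable.comp (by fun_prop)
  have hm1 : Measurable fun r : ℝ => sphereModulus Ω (ρ / r) / ENNReal.ofReal r :=
    hmω.div (by fun_prop)
  have hm2 : Measurable fun r : ℝ => ENNReal.ofReal (ρ / r) / ENNReal.ofReal r := by fun_prop
  have hm3 : ∀ c, Measurable fun r : ℝ =>
      (Icc (c / 2) (2 * c)).indicator (1 : ℝ → ℝ≥0∞) r / ENNReal.ofReal r := fun c =>
    (measurable_one.indicator measurableSet_Icc).div (by fun_prop)
  have hsub : Ici ρ ⊆ Ioi 0 := fun r hr => hρ.trans_le hr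
  have h1 : ∫⁻ r in Ici ρ, sphereModulus Ω (ρ / r) / ENNReal.ofReal r ≤ ENNReal.ofReal B₂ := by
    rw [lintegral_Ici_comp_div (φ := sphereModulus Ω) hρ]
    exact hΩ.dini
  have h2 : ∫⁻ r in Ici ρ, ENNReal.ofReal (ρ / r) / ENNReal.ofReal r ≤ 1 := by
    rw [lintegral_Ici_comp_div (φ := ENNReal.ofReal) hρ]
    calc ∫⁻ δ in Ioc (0 : ℝ) 1, ENNReal.ofReal δ / ENNReal.ofReal δ
        ≤ ∫⁻ δ in Ioc (0 : ℝ) 1, 1 := lintegral_mono fun δ => ENNReal.div_self_le_one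
      _ = 1 := by simp
  have h3 : ∀ c, 0 < c → ∫⁻ r in Ici ρ, (Icc (c / 2) (2 * c)).indicator (1 : ℝ → ℝ≥0∞) r /
      ENNReal.ofReal r ≤ 3 := fun c hc =>
    (lintegral_mono_set hsub).trans (setLIntegral_Icc_inv_le hc)
  calc ∫⁻ r in Ioi (0 : ℝ), (Ici ρ).indicator (hormanderMajorant Ω a b ρ) r / ENNReal.ofReal r
      = ∫⁻ r in Ici ρ, hormanderMajorant Ω a b ρ r / ENNReal.ofReal r := by
        have : ∀ r, (Ici ρ).indicator (hormanderMajorant Ω a b ρ) r / ENNReal.ofReal r =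
            (Ici ρ).indicator (fun r => hormanderMajorant Ω a b ρ r / ENNReal.ofReal r) r := by
          intro r
          by_cases hr : r ∈ Ici ρ
          · simp only [indicator_of_mem hr]
          · simp only [indicator_of_notMem hr, ENNReal.zero_div]
        simp only [this]
        rw [lintegral_indicator measurableSet_Ici, Measure.restrict_restrict measurableSet_Ici,
          inter_eq_left.2 hsub]
    _ = (∫⁻ r in Ici ρ, sphereModulus Ω (ρ / r) / ENNReal.ofReal r) +
        (∫⁻ r in Ici ρ, ENNReal.ofReal (ρ / r) / ENNReal.ofReal r) +
        (∫⁻ r in Ici ρ, (Icc (a / 2) (2 * a)).indicator (1 : ℝ → ℝ≥0∞) r / ENNReal.ofReal r) +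
        ∫⁻ r in Ici ρ, (Icc (b / 2) (2 * b)).indicator (1 : ℝ → ℝ≥0∞) r / ENNReal.ofReal r := by
        simp only [hormanderMajorant, ENNReal.add_div]
        rw [lintegral_add_right _ (hm3 b), lintegral_add_right _ (hm3 a), lintegral_add_right _ hm2]
    _ ≤ ENNReal.ofReal B₂ + 1 + 3 + 3 := by
        gcongr
        exacts [h3 a ha, h3 b hb]
    _ = ENNReal.ofReal B₂ + 7 := by
        rw [add_assoc, add_assoc]
        norm_num

theorem IsDiniKernel.lintegral_radialRestrict_sub_le (hn : 1 ≤ n) (hΩ : IsDiniKernel Ω B₁ B₂)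
    {β H a b : ℝ} (hH : ∀ r, 0 < r → r < b → r ^ β ≤ H) (hβ0 : 0 ≤ β) (hβ : β ≤ n) (hB₁ : 0 ≤ B₁)
    (hH0 : 0 ≤ H) (ha : 0 < a) (hb : 0 < b) (h : EuclideanSpace ℝ (Fin n)) :
    ∫⁻ y in {y | 2 * ‖h‖ ≤ ‖y‖},
      ‖radialRestrict Ω β (Ico a b) (y - h) - radialRestrict Ω β (Ico a b) y‖ₑ ≤
      ENNReal.ofReal ((1 + B₁ * n + B₁) * (H * 2 ^ n)) *
        (n * volume (ball (0 : EuclideanSpace ℝ (Fin n)) 1) * (ENNReal.ofReal B₂ + 7)) := by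
  have : Nonempty (Fin n) := ⟨⟨0, hn⟩⟩
  by_cases hh : h = 0
  · simp [hh]
  have hρ : 0 < 2 * ‖h‖ := by have := norm_pos_iff.2 hh; positivity
  set ρ := 2 * ‖h‖ with hρ_def
  have hm : MeasurableSet {y : EuclideanSpace ℝ (Fin n) | ρ ≤ ‖y‖} :=
    measurableSet_le measurable_const measurable_norm
  have hmM : Measurable (hormanderMajorant Ω a b ρ) := by
    have hmω : Measurable fun r => sphereModulus Ω (ρ / r) :=
      (monotone_sphereModulus Ω).measurable.comp (by fun_prop)
    exact ((hmω.add (by fun_prop)).add (measurable_one.indicator measurableSet_Icc)).add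
      (measurable_one.indicator measurableSet_Icc)
  have hmG : Measurable ((Ici ρ).indicator (hormanderMajorant Ω a b ρ)) :=
    hmM.indicator measurableSet_Ici
  have hG := lintegral_fun_norm_div_pow_eq (E := EuclideanSpace ℝ (Fin n)) hmG
  simp only [finrank_euclideanSpace_fin] at hG
  calc _ ≤ ∫⁻ y : EuclideanSpace ℝ (Fin n), ENNReal.ofReal ((1 + B₁ * n + B₁) * (H * 2 ^ n)) *
        ((Ici ρ).indicator (hormanderMajorant Ω a b ρ) ‖y‖ / ENNReal.ofReal (‖y‖ ^ n)) := by
        rw [← lintegral_indicator hm]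
        refine lintegral_mono fun y => indicator_apply_le' (fun hy => ?_) (fun _ => zero_le)
        have hy' : ρ ≤ ‖y‖ := hy
        have hy0 : 0 < ‖y‖ := hρ.trans_le hy'
        have hnorm : 2 * ‖y - h - y‖ = ρ := by rw [sub_sub_cancel_left, norm_neg]
        have h1 := hΩ.enorm_radialRestrict_sub_le hH hβ0 hβ hB₁ hH0 ha (norm_pos_iff.1 hy0)
          (z := y - h) (by rw [hnorm]; exact hy')
        rw [hnorm] at h1
        refine h1.trans (le_of_eq ?_)
        rw [indicator_of_mem (mem_Ici.2 hy'), ← mul_div_assoc, ENNReal.ofReal_div_of_pos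
          (by positivity), div_eq_mul_inv, div_eq_mul_inv, mul_right_comm,
          mul_assoc]
    _ = ENNReal.ofReal ((1 + B₁ * n + B₁) * (H * 2 ^ n)) *
        (n * volume (ball (0 : EuclideanSpace ℝ (Fin n)) 1) * ∫⁻ r in Ioi (0 : ℝ),
          (Ici ρ).indicator (hormanderMajorant Ω a b ρ) r / ENNReal.ofReal r) := by
        rw [lintegral_const_mul' _ _ ENNReal.ofReal_ne_top, hG]
    _ ≤ _ := by
        gcongr
        exact hΩ.lintegral_hormanderMajorant_le ha hb hρ

theorem indicator_radialRestrict_Ico (β a b s : ℝ) :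
    {z | s ≤ ‖z‖}.indicator (radialRestrict Ω β (Ico a b)) =
      radialRestrict Ω β (Ico (max a s) b) := by
  rw [radialRestrict, radialRestrict, indicator_indicator]
  congr 1
  ext z
  simp only [mem_inter_iff, mem_ofPred_eq, mem_Ico, max_le_iff]
  tauto

/-- Annular truncations of `Ω(y) |y|^(β - n)` are Calderón–Zygmund kernels, uniformly as long as
`|y|^β` stays bounded on the annulus. -/
theorem IsDiniKernel.exists_isCZKernel (hn : 1 ≤ n) {H : ℝ} (hB₁ : 0 ≤ B₁) (hH0 : 0 ≤ H) :
    ∃ A : ℝ≥0, ∀ Ω : EuclideanSpace ℝ (Fin n) → ℝ, IsDiniKernel Ω B₁ B₂ → ∀ β a b : ℝ, 0 ≤ β →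
      β ≤ n → 0 < a → 0 < b → (∀ r, 0 < r → r < b → r ^ β ≤ H) →
      IsCZKernel (radialRestrict Ω β (Ico a b)) A := by
  have : Nonempty (Fin n) := ⟨⟨0, hn⟩⟩
  set V : ℝ≥0∞ := ENNReal.ofReal ((1 + B₁ * n + B₁) * (H * 2 ^ n)) *
    (n * volume (ball (0 : EuclideanSpace ℝ (Fin n)) 1) * (ENNReal.ofReal B₂ + 7)) with hV
  have hv : volume (ball (0 : EuclideanSpace ℝ (Fin n)) 1) ≠ ∞ := measure_ball_lt_top.ne
  have hVfin : V ≠ ∞ := by finiteness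
  -- V serves the Hörmander condition and B₁H the size condition.
  refine ⟨V.toNNReal + (B₁ * H).toNNReal, fun Ω hΩ β a b hβ0 hβ ha hb hH => ?_⟩
  have h0 : (0 : ℝ) ∉ Ico a b := fun h => absurd h.1 (not_le.2 ha)
  refine ⟨hΩ.measurable_radialRestrict β measurableSet_Ico h0, fun y => ?_, ⟨a, b, ha, fun y hy => ?_⟩,
    fun r => ?_, fun s h => ?_⟩
  · rw [finrank_euclideanSpace_fin]
    by_cases hy : ‖y‖ ∈ Ico a b
    · have hy0 : 0 < ‖y‖ := ha.trans_le hy.1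
      have h1 := hΩ.abs_radialRestrict_le hH hB₁ hH0 ha y
      rw [← mul_div_assoc, le_div_iff₀ (by positivity)] at h1
      refine h1.trans ?_
      rw [NNReal.coe_add, Real.coe_toNNReal _ (by positivity)]
      exact le_add_of_nonneg_left (NNReal.coe_nonneg _)
    · rw [radialRestrict, indicator_of_notMem (show y ∉ {y | ‖y‖ ∈ Ico a b} from hy), abs_zero,
        zero_mul]
      exact NNReal.coe_nonneg _
  · by_contra hcon
    refine hy (indicator_of_notMem (show y ∉ {y | ‖y‖ ∈ Ico a b} from fun h => ?_) _)
    exact hcon ⟨h.1, (show ‖y‖ ∈ Ico a b from h).2.le⟩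
  -- On a ball intersected with the annulus the kernel is still Ω times a radial function.
  · rw [← integral_mul_fun_norm_eq_zero hΩ.homogeneous hΩ.cancellation
      ((Iio r ∩ Ico a b).indicator fun t => 1 / t ^ ((n : ℝ) - β)),
      ← integral_indicator measurableSet_ball]
    congr 1 with y
    rw [radialRestrict, indicator_indicator]
    by_cases hy : ‖y‖ ∈ Iio r ∩ Ico a b
    · rw [indicator_of_mem hy, indicator_of_mem]
      · ring
      · exact ⟨by simpa using hy.1, hy.2⟩
    · rw [indicator_of_notMem hy, indicator_of_notMem, mul_zero]
      rintro ⟨h1, h2⟩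
      exact hy ⟨by simpa using h1, h2⟩
  -- An exterior truncation only raises the inner radius to max a s, and the bound does not depend
  -- on the inner radius.
  · simp only [indicator_radialRestrict_Ico]
    refine (hΩ.lintegral_radialRestrict_sub_le hn hH hβ0 hβ hB₁ hH0 (lt_max_of_lt_left ha) hb
      h).trans ?_
    rw [ENNReal.coe_add, ENNReal.coe_toNNReal hVfin]
    exact le_self_add

end NearKernel

/-! ### The cut at radius 1/β and the far part. -/

section Truncations

variable {n : ℕ} {Ω : EuclideanSpace ℝ (Fin n) → ℝ} {B₁ B₂ : ℝ}

/-- From log(1/β) ≤ 1/β - 1 one gets -β log β ≤ 1 - β ≤ 1. The bound serves twice: for r^β on the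
near part and for the spare factor β^(-β) in the far norm. -/
theorem rpow_neg_self_le_exp_one {β : ℝ} (hβ : 0 < β) : β ^ (-β) ≤ Real.exp 1 := by
  rw [Real.rpow_def_of_pos hβ, Real.exp_le_exp]
  have h1 := Real.log_le_sub_one_of_pos (inv_pos.2 hβ)
  rw [Real.log_inv] at h1
  have h2 := mul_le_mul_of_nonneg_right h1 hβ.le
  rw [sub_mul, inv_mul_cancel₀ hβ.ne'] at h2
  linarith

theorem rpow_le_exp_one_of_lt_inv {β r : ℝ} (hβ : 0 < β) (hr : 0 < r) (h : r < β⁻¹) :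
    r ^ β ≤ Real.exp 1 := by
  refine (Real.rpow_le_rpow hr.le h.le hβ.le).trans ?_
  rw [Real.inv_rpow hβ.le, ← Real.rpow_neg hβ.le]
  exact rpow_neg_self_le_exp_one hβ

theorem IsDiniKernel.abs_radialRestrict_le_of_subset_Ici (hΩ : IsDiniKernel Ω B₁ B₂) (hB₁ : 0 ≤ B₁)
    {β c : ℝ} (hβ : β ≤ n) (hc : 0 < c) {I : Set ℝ} (hI : I ⊆ Ici c)
    (y : EuclideanSpace ℝ (Fin n)) : |radialRestrict Ω β I y| ≤ B₁ / c ^ ((n : ℝ) - β) := by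
  by_cases hy : ‖y‖ ∈ I
  · have hcy : c ≤ ‖y‖ := hI hy
    have hy0 : 0 < ‖y‖ := hc.trans_le hcy
    rw [radialRestrict, indicator_of_mem (show y ∈ {y | ‖y‖ ∈ I} from hy), abs_div,
      abs_of_nonneg (by positivity : 0 ≤ ‖y‖ ^ ((n : ℝ) - β))]
    have h0 : 0 ≤ (n : ℝ) - β := by linarith
    gcongr
    exact hΩ.bounded y (norm_pos_iff.1 hy0)
  · rw [radialRestrict, indicator_of_notMem (show y ∉ {y | ‖y‖ ∈ I} from hy), abs_zero]
    positivity

/-- Away from the origin the kernel is bounded since β ≤ n, so f ∈ L¹ gives absolute convergence at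
every x, not merely almost everywhere. -/
theorem IsDiniKernel.integrable_radialRestrict_mul (hΩ : IsDiniKernel Ω B₁ B₂) (hB₁ : 0 ≤ B₁)
    {β c : ℝ} (hβ : β ≤ n) (hc : 0 < c) {I : Set ℝ} (hIm : MeasurableSet I) (hI : I ⊆ Ici c)
    {f : EuclideanSpace ℝ (Fin n) → ℝ} (hf : Integrable f) (x : EuclideanSpace ℝ (Fin n)) :
    Integrable fun y => radialRestrict Ω β I y * f (x - y) :=
  (hf.comp_sub_left x).bdd_mul (c := B₁ / c ^ ((n : ℝ) - β))
    (hΩ.measurable_radialRestrict β hIm fun h => absurd (hI h) (not_le.2 hc)).aestronglyMeasurable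
    (Eventually.of_forall (hΩ.abs_radialRestrict_le_of_subset_Ici hB₁ hβ hc hI))

/-- In polar coordinates the integrand is at most B₁^q r^(n-1-(n-β)q) = B₁^q r^(-κ-1) with κ =
n(q-1) - βq. Integrating from R ≤ c instead of c makes the bound independent of ε when R = 1/β. -/
theorem IsDiniKernel.lintegral_radialRestrict_Ici_rpow_le (hn : 1 ≤ n) (hΩ : IsDiniKernel Ω B₁ B₂)
    (hB₁ : 0 ≤ B₁) {β q c R : ℝ} (hq : 0 < q) (hκ : 0 < n * (q - 1) - β * q) (hR : 0 < R)
    (hRc : R ≤ c) :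
    ∫⁻ y, ‖radialRestrict Ω β (Ici c) y‖ₑ ^ q ≤
      n * volume (ball (0 : EuclideanSpace ℝ (Fin n)) 1) *
        ENNReal.ofReal (B₁ ^ q * (R ^ (-(n * (q - 1) - β * q)) / (n * (q - 1) - β * q))) := by
  have : Nonempty (Fin n) := ⟨⟨0, hn⟩⟩
  set κ := n * (q - 1) - β * q with hκ_def
  set γ : ℝ := (n : ℝ) - β with hγ
  have hgm : Measurable ((Ici R).indicator fun r : ℝ => ENNReal.ofReal ((B₁ / r ^ γ) ^ q)) :=
    Measurable.indicator (by fun_prop) measurableSet_Ici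
  have hrad := lintegral_fun_norm_eq (E := EuclideanSpace ℝ (Fin n)) hgm
  rw [finrank_euclideanSpace_fin] at hrad
  calc ∫⁻ y, ‖radialRestrict Ω β (Ici c) y‖ₑ ^ q
      ≤ ∫⁻ y : EuclideanSpace ℝ (Fin n),
          (Ici R).indicator (fun r : ℝ => ENNReal.ofReal ((B₁ / r ^ γ) ^ q)) ‖y‖ := by
        refine lintegral_mono fun y => ?_
        by_cases hy : ‖y‖ ∈ Ici c
        · have hRy : R ≤ ‖y‖ := hRc.trans hy
          have hy0 : 0 < ‖y‖ := hR.trans_le hRy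
          rw [indicator_of_mem (mem_Ici.2 hRy), radialRestrict,
            indicator_of_mem (show y ∈ {y | ‖y‖ ∈ Ici c} from hy), Real.enorm_eq_ofReal_abs,
            ENNReal.ofReal_rpow_of_nonneg (abs_nonneg _) hq.le, abs_div,
            abs_of_nonneg (by positivity : 0 ≤ ‖y‖ ^ γ)]
          refine ENNReal.ofReal_le_ofReal ?_
          gcongr
          exact hΩ.bounded y (norm_pos_iff.1 hy0)
        · rw [radialRestrict, indicator_of_notMem (show y ∉ {y | ‖y‖ ∈ Ici c} from hy), enorm_zero,
            ENNReal.zero_rpow_of_pos hq]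
          exact zero_le
    _ = n * volume (ball (0 : EuclideanSpace ℝ (Fin n)) 1) * ∫⁻ r in Ioi (0 : ℝ),
          ENNReal.ofReal (r ^ (n - 1)) *
            (Ici R).indicator (fun r : ℝ => ENNReal.ofReal ((B₁ / r ^ γ) ^ q)) r := hrad
    _ = n * volume (ball (0 : EuclideanSpace ℝ (Fin n)) 1) * ∫⁻ r in Ioi R,
          ENNReal.ofReal (B₁ ^ q) * ENNReal.ofReal (r ^ (-κ - 1)) := by
        congr 1
        have h1 : ∀ r, ENNReal.ofReal (r ^ (n - 1)) *
            (Ici R).indicator (fun r : ℝ => ENNReal.ofReal ((B₁ / r ^ γ) ^ q)) r =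
            (Ici R).indicator (fun r => ENNReal.ofReal (B₁ ^ q) *
              ENNReal.ofReal (r ^ (-κ - 1))) r := by
          intro r
          by_cases hr : r ∈ Ici R
          · have hr0 : 0 < r := hR.trans_le hr
            rw [indicator_of_mem hr, indicator_of_mem hr, ← ENNReal.ofReal_mul (by positivity),
              ← ENNReal.ofReal_mul (by positivity), Real.div_rpow hB₁ (by positivity),
              ← Real.rpow_mul hr0.le, ← Real.rpow_natCast, Nat.cast_sub hn, mul_div_left_comm,
              ← Real.rpow_sub hr0]
            congr 3
            rw [hκ_def, hγ]
            push_cast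
            ring
          · rw [indicator_of_notMem hr, indicator_of_notMem hr, mul_zero]
        simp only [h1]
        have hsub : Ici R ∩ Ioi 0 = Ici R := inter_eq_left.2 fun r hr => mem_Ioi.2 (hR.trans_le hr)
        rw [lintegral_indicator measurableSet_Ici, Measure.restrict_restrict measurableSet_Ici,
          hsub, Measure.restrict_congr_set Ioi_ae_eq_Ici.symm]
    _ = _ := by
        rw [lintegral_const_mul' _ _ ENNReal.ofReal_ne_top, setLIntegral_Ioi_rpow (by linarith) hR,
          ← ENNReal.ofReal_mul (by positivity)]
        congr 3
        rw [sub_add_cancel, neg_div_neg_eq]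

/-- The tail beyond radius `1 / β` is small in `L^q`. -/
theorem IsDiniKernel.eLpNorm_radialRestrict_Ici_le (hn : 1 ≤ n) (hΩ : IsDiniKernel Ω B₁ B₂)
    (hB₁ : 0 ≤ B₁) {β q c : ℝ} (hq : 0 < q) (hβ : 0 < β) (hκ : 0 < n * (q - 1) - β * q)
    (hc : β⁻¹ ≤ c) :
    eLpNorm (radialRestrict Ω β (Ici c)) (ENNReal.ofReal q) ≤
      (n * volume (ball (0 : EuclideanSpace ℝ (Fin n)) 1)) ^ (1 / q) *
        ENNReal.ofReal (B₁ * Real.exp 1) *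
        ENNReal.ofReal (β ^ ((q - 1) * n / q) / (n * (q - 1) - β * q) ^ (1 / q)) := by
  rw [eLpNorm_ofReal_eq _ hq]
  set κ := n * (q - 1) - β * q with hκ_def
  have h1 := hΩ.lintegral_radialRestrict_Ici_rpow_le hn hB₁ hq hκ (inv_pos.2 hβ) hc
  refine (ENNReal.rpow_le_rpow h1 (by positivity : 0 ≤ 1 / q)).trans ?_
  rw [ENNReal.mul_rpow_of_nonneg _ _ (by positivity), mul_assoc, ← ENNReal.ofReal_mul (by positivity),
    ENNReal.ofReal_rpow_of_nonneg (by positivity) (by positivity)]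
  gcongr
  rw [Real.mul_rpow (by positivity) (by positivity), ← Real.rpow_mul hB₁, mul_one_div_cancel hq.ne',
    Real.rpow_one, Real.div_rpow (by positivity) hκ.le, mul_assoc]
  gcongr
  rw [← mul_div_assoc]
  gcongr
  rw [Real.inv_rpow hβ.le, ← Real.rpow_neg hβ.le, neg_neg, ← Real.rpow_mul hβ.le]
  -- The exponent κ/q falls short of (q-1)n/q by β, and the missing factor β^(-β) is absorbed into
  -- e.
  have h2 : κ * (1 / q) = -β + (q - 1) * n / q := by
    rw [hκ_def]
    field_simp
    ring
  rw [h2, Real.rpow_add hβ]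
  gcongr
  exact rpow_neg_self_le_exp_one hβ

theorem truncOp_eq_convOp (Ω f : EuclideanSpace ℝ (Fin n) → ℝ) (β ε : ℝ) :
    truncOp Ω β ε f = convOp (radialRestrict Ω β (Ici ε)) f := by
  ext x
  have hm : MeasurableSet {y : EuclideanSpace ℝ (Fin n) | ε ≤ ‖y‖} :=
    measurableSet_le measurable_const measurable_norm
  rw [convOp_eq_integral_swap, truncOp, ← integral_indicator hm]
  congr 1 with y
  simp only [radialRestrict, indicator, truncIntegrand, mem_ofPred_eq, mem_Ici]
  split_ifs <;> simp

theorem radialRestrict_Ici_eq_add (Ω : EuclideanSpace ℝ (Fin n) → ℝ) (β ε R : ℝ)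
    (y : EuclideanSpace ℝ (Fin n)) : radialRestrict Ω β (Ici ε) y =
      radialRestrict Ω β (Ico ε R) y + radialRestrict Ω β (Ici (max ε R)) y := by
  simp only [radialRestrict, indicator, mem_ofPred_eq, mem_Ici, mem_Ico, max_le_iff]
  by_cases h1 : ε ≤ ‖y‖
  · by_cases h2 : R ≤ ‖y‖
    · simp [h1, h2, not_lt.2 h2]
    · simp [h1, h2, not_le.1 h2]
  · simp [h1]

end Truncations

/-! ### The main theorem. -/

theorem theorem1p2 (n : ℕ) (hn : 1 ≤ n) (q : ℝ) (hq : 1 < q)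
    (B₁ B₂ : ℝ) (hB₁ : 0 < B₁) (hB₂ : 0 < B₂)
    (β₀ : ℝ) (hβ₀ : 0 < β₀) (hβ₀' : β₀ < 1 / 2) :
    ∃ C : ℝ, 0 < C ∧
      ∀ Ω : EuclideanSpace ℝ (Fin n) → ℝ, IsDiniKernel Ω B₁ B₂ →
      ∀ f : EuclideanSpace ℝ (Fin n) → ℝ,
        MemLp f 1 volume → MemLp f (ENNReal.ofReal q) volume →
      ∀ ε : ℝ, 0 < ε →
      ∀ β : ℝ, 0 < β → β < min (1 - β₀) ((q - 1) * n / q) →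
        (∀ x, IntegrableOn (truncIntegrand Ω β f x) {y | ε ≤ ‖y‖} volume) ∧
        MemLp (truncOp Ω β ε f) (ENNReal.ofReal q) volume ∧
        eLpNorm (truncOp Ω β ε f) (ENNReal.ofReal q) volume ≤
          ENNReal.ofReal C *
            (eLpNorm f (ENNReal.ofReal q) volume +
              ENNReal.ofReal
                (β ^ ((q - 1) * n / q) / ((n : ℝ) * (q - 1) - β * q) ^ (1 / q)) *
                eLpNorm f 1 volume) := by
  have : Nonempty (Fin n) := ⟨⟨0, hn⟩⟩
  have hq0 : 0 < q := by linarith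
  obtain ⟨A, hA⟩ := IsDiniKernel.exists_isCZKernel (B₂ := B₂) hn hB₁.le (Real.exp_pos 1).le
  obtain ⟨C₁, hC₁⟩ := IsCZKernel.exists_eLpNorm_le hn A hq
  set C₂ : ℝ≥0∞ := (n * volume (ball (0 : EuclideanSpace ℝ (Fin n)) 1)) ^ (1 / q) *
    ENNReal.ofReal (B₁ * Real.exp 1) with hC₂
  have hC₂fin : C₂ ≠ ∞ := by
    have hv : volume (ball (0 : EuclideanSpace ℝ (Fin n)) 1) ≠ ∞ := measure_ball_lt_top.ne
    exact ENNReal.mul_ne_top (ENNReal.rpow_ne_top_of_nonneg (by positivity) (by finiteness))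
      ENNReal.ofReal_ne_top
  have hC₂' : 0 ≤ C₂.toReal := ENNReal.toReal_nonneg
  -- C₁ bounds the near part and C₂ the far part; the 1 only makes the constant positive.
  refine ⟨C₁ + C₂.toReal + 1, by positivity, fun Ω hΩ f hf1 hfq ε hε β hβ hβlt => ?_⟩
  have hf : Integrable f := memLp_one_iff_integrable.1 hf1
  have hβq : β < (q - 1) * n / q := hβlt.trans_le (min_le_right _ _)
  have hκ : 0 < n * (q - 1) - β * q := by
    rw [lt_div_iff₀ hq0] at hβq
    linarith
  have hβn : β ≤ n := by
    refine hβq.le.trans ?_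
    rw [div_le_iff₀ hq0]
    have : (0 : ℝ) ≤ n := Nat.cast_nonneg n
    linarith
  have hm : MeasurableSet {y : EuclideanSpace ℝ (Fin n) | ε ≤ ‖y‖} :=
    measurableSet_le measurable_const measurable_norm
  have hR : 0 < β⁻¹ := inv_pos.2 hβ
  -- If ε ≥ 1/β the near annulus is empty and the far part is the whole kernel, so no case
  -- distinction is needed.
  set near := radialRestrict Ω β (Ico ε β⁻¹) with hnear
  set far := radialRestrict Ω β (Ici (max ε β⁻¹)) with hfar
  have hnearCZ : IsCZKernel near A := hA Ω hΩ β ε β⁻¹ hβ.le hβn hε hR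
    fun r hr hrb => rpow_le_exp_one_of_lt_inv hβ hr hrb
  have hfarm : AEStronglyMeasurable far := (hΩ.measurable_radialRestrict β measurableSet_Ici
    fun h => absurd (mem_Ici.1 h) (not_le.2 (lt_max_of_lt_left hε))).aestronglyMeasurable
  have hsplit : truncOp Ω β ε f = convOp near f + convOp far f := by
    rw [truncOp_eq_convOp]
    ext x
    rw [Pi.add_apply, convOp_eq_integral_swap, convOp_eq_integral_swap, convOp_eq_integral_swap,
      ← integral_add
        (hΩ.integrable_radialRestrict_mul hB₁.le hβn hε measurableSet_Ico Ico_subset_Ici_self hf x)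
        (hΩ.integrable_radialRestrict_mul hB₁.le hβn hε measurableSet_Ici
          (Ici_subset_Ici.2 (le_max_left _ _)) hf x)]
    congr 1 with y
    rw [radialRestrict_Ici_eq_add Ω β ε β⁻¹ y, add_mul]
  have hnearq : MemLp (convOp near f) (ENNReal.ofReal q) :=
    memLp_convOp hnearCZ.integrable hq.le hfq
  have hfarle : eLpNorm (convOp far f) (ENNReal.ofReal q) ≤ C₂ *
      ENNReal.ofReal (β ^ ((q - 1) * n / q) / ((n : ℝ) * (q - 1) - β * q) ^ (1 / q)) *
        eLpNorm f 1 :=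
    (eLpNorm_convOp_le_left hfarm hf.1 hq.le).trans (mul_le_mul_left
      (hΩ.eLpNorm_radialRestrict_Ici_le hn hB₁.le hq0 hβ hκ (le_max_right _ _)) _)
  have hfarq : MemLp (convOp far f) (ENNReal.ofReal q) :=
    ⟨aestronglyMeasurable_convOp hfarm hf.1, hfarle.trans_lt (ENNReal.mul_lt_top
      (ENNReal.mul_lt_top hC₂fin.lt_top ENNReal.ofReal_lt_top) hf1.2)⟩
  refine ⟨fun x => ?_, ?_, ?_⟩
  · rw [← integrable_indicator_iff hm]
    refine (hΩ.integrable_radialRestrict_mul hB₁.le hβn hε measurableSet_Ici subset_rfl hf x).congr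
      (Eventually.of_forall fun y => ?_)
    simp only [radialRestrict, indicator, truncIntegrand, mem_ofPred_eq, mem_Ici]
    split_ifs <;> simp
  · rw [hsplit]
    exact hnearq.add hfarq
  · have hC : ENNReal.ofReal (C₁ + C₂.toReal + 1) = C₁ + C₂ + 1 := by
      rw [ENNReal.ofReal_add (by positivity) zero_le_one, ENNReal.ofReal_add (by positivity) hC₂',
        ENNReal.ofReal_toReal hC₂fin, ENNReal.ofReal_coe_nnreal, ENNReal.ofReal_one]
    have h1 : eLpNorm (truncOp Ω β ε f) (ENNReal.ofReal q) ≤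
        eLpNorm (convOp near f) (ENNReal.ofReal q) + eLpNorm (convOp far f) (ENNReal.ofReal q) := by
      rw [hsplit]
      exact eLpNorm_add_le hnearq.1 hfarq.1 (by
        rw [← ENNReal.ofReal_one]
        exact ENNReal.ofReal_le_ofReal hq.le)
    have h2 := hC₁ near hnearCZ f hf hfq
    rw [hC, mul_add]
    refine h1.trans (add_le_add (h2.trans ?_) (hfarle.trans ?_))
    · gcongr
      rw [add_assoc]
      exact le_self_add
    · rw [mul_assoc]
      gcongr
      rw [add_right_comm]
      exact le_add_self
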